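/- Let $n\in\mathbb N$ and let $\Omega\subset\mathbb R^n$ be a bounded Lipschitz domain (that is, a bounded, connected, nonempty open set which near each of its boundary points is, in suitable orthonormal coordinates, the strict epigraph of a Lipschitz function). Let $v_0:\Omega\to\mathbb R$ be differentiable with $\nabla v_0\in[C^1(\Omega)]^n$, where $C^1(\Omega)$ denotes the space of continuously differentiable functions on $\Omega$ that are bounded together with their first derivatives, and let $q\in L^\infty(\Omega;\mathbb C)$. For either choice of sign consider the equation $$\Delta m\pm\nabla v_0\cdot\nabla m+qm=0\quad\text{in }\Omega. \tag{1}$$ Then there exist constants $C>0$ and $R>0$, depending only on $n$, $\Omega$, $v_0$, $q$ and the sign, such that for every $\xi\in\mathbb C^n$ with $\xi\cdot\xi=\sum_{i}\xi_i^2=0$ and $|\xi|\ge R$ there is a function $\omega=\omega(\,\cdot\,;\xi)\in H^1(\Omega;\mathbb C)$ such that $$m(x)=e^{\xi\cdot x\mp\frac12 v_0(x)}\bigl(1+\omega(x;\xi)\bigr),\qquad \xi\cdot x=\sum_i\xi_i x_i,$$ (with the lower sign exactly when the lower sign is taken in (1)) belongs to $H^1(\Omega;\mathbb C)$ and is a weak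 solution of (1), i.e. $$-\int_\Omega\nabla m\cdot\nabla\varphi\,dx\pm\int_\Omega(\nabla v_0\cdot\nabla m)\,\varphi\,dx+\int_\Omega q\,m\,\varphi\,dx=0\qquad\text{for all }\varphi\in C_c^\infty(\Omega),$$ and $$\|\omega(\,\cdot\,;\xi)\|_{L^2(\Omega)}\le C|\xi|^{-1}.$$ -/

import Mathlib

namespace CGO

open MeasureTheory Metric
open scoped ContDiff

/-- The `i`-th partial derivative of a real function on `ℝⁿ`. -/
noncomputable def partialDeriv {n : ℕ} (i : Fin n)
    (f : EuclideanSpace ℝ (Fin n) → ℝ) (x : EuclideanSpace ℝ (Fin n)) : ℝ :=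
  fderiv ℝ f x (EuclideanSpace.single i 1)

/-- A bounded Lipschitz domain: bounded, open, connected, and, near each boundary point `p`, equal
to the strict epigraph `{x | γ x' < x_e}` of a Lipschitz function `γ`, where `x_e = ⟪e, x⟫` is
the height in some unit direction `e` and `x' = x - x_e e` lies in the hyperplane orthogonal
to `e`. -/
structure IsBoundedLipschitzDomain {n : ℕ} (Ω : Set (EuclideanSpace ℝ (Fin n))) : Prop where
  isOpen : IsOpen Ω
  isConnected : IsConnected Ω
  isBounded : Bornology.IsBounded Ω
  lipschitz_boundary : ∀ p ∈ frontier Ω,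
    ∃ (e : EuclideanSpace ℝ (Fin n)) (γ : EuclideanSpace ℝ (Fin n) → ℝ) (K : NNReal) (r : ℝ),
      ‖e‖ = 1 ∧ LipschitzWith K γ ∧ 0 < r ∧
        ∀ x ∈ ball p r, x ∈ Ω ↔ γ (x - (inner ℝ e x : ℝ) • e) < inner ℝ e x

/-- Membership in the Banach space `C¹(Ω)`: `f` is continuously differentiable on the open
set `Ω` and its `C¹` norm (suprema of `f` and of its first partial derivatives) is finite. -/
def MemC1 {n : ℕ} (Ω : Set (EuclideanSpace ℝ (Fin n)))
    (f : EuclideanSpace ℝ (Fin n) → ℝ) : Prop :=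
  ContDiffOn ℝ 1 f Ω ∧ ∃ M : ℝ, ∀ x ∈ Ω, |f x| ≤ M ∧ ∀ j, |partialDeriv j f x| ≤ M

/-- `φ ∈ C_c^∞(Ω)`. -/
def IsTestFunction {n : ℕ} (Ω : Set (EuclideanSpace ℝ (Fin n)))
    (φ : EuclideanSpace ℝ (Fin n) → ℝ) : Prop :=
  ContDiff ℝ ∞ φ ∧ HasCompactSupport φ ∧ tsupport φ ⊆ Ω

/-- `g = (g₁, …, gₙ)` is the weak gradient of `u` on `Ω`. -/
def IsWeakGradient {n : ℕ} (Ω : Set (EuclideanSpace ℝ (Fin n)))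
    (u : EuclideanSpace ℝ (Fin n) → ℂ) (g : Fin n → EuclideanSpace ℝ (Fin n) → ℂ) : Prop :=
  ∀ i, ∀ φ, IsTestFunction Ω φ →
    ∫ x in Ω, u x * (partialDeriv i φ x : ℂ) = -∫ x in Ω, g i x * (φ x : ℂ)

/-- `u ∈ H¹(Ω)` with weak gradient `g`. -/
def MemH1With {n : ℕ} (Ω : Set (EuclideanSpace ℝ (Fin n)))
    (u : EuclideanSpace ℝ (Fin n) → ℂ) (g : Fin n → EuclideanSpace ℝ (Fin n) → ℂ) : Prop :=
  MemLp u 2 (volume.restrict Ω) ∧ (∀ i, MemLp (g i) 2 (volume.restrict Ω)) ∧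
    IsWeakGradient Ω u g

/-- `u ∈ H¹(Ω)` (complex-valued). -/
def MemH1 {n : ℕ} (Ω : Set (EuclideanSpace ℝ (Fin n)))
    (u : EuclideanSpace ℝ (Fin n) → ℂ) : Prop :=
  ∃ g, MemH1With Ω u g

/-- `m ∈ H¹(Ω)` is a weak solution of `Δ m + s ∇v₀ · ∇m + q m = 0` in `Ω`. -/
def IsWeakSolution {n : ℕ} (Ω : Set (EuclideanSpace ℝ (Fin n))) (s : ℝ)
    (v₀ : EuclideanSpace ℝ (Fin n) → ℝ) (q m : EuclideanSpace ℝ (Fin n) → ℂ) : Prop :=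
  ∃ g, MemH1With Ω m g ∧ ∀ φ, IsTestFunction Ω φ →
    -(∫ x in Ω, ∑ i, g i x * (partialDeriv i φ x : ℂ))
      + (∫ x in Ω, (s : ℂ) * (∑ i, (partialDeriv i v₀ x : ℂ) * g i x) * (φ x : ℂ))
      + (∫ x in Ω, q x * m x * (φ x : ℂ)) = 0

/-- The function `e^{ξ·x - s v₀/2} (1 + w)`, where `ξ·x = ∑ ξᵢ xᵢ` is bilinear. -/
noncomputable def cgoForm {n : ℕ} (s : ℝ) (v₀ : EuclideanSpace ℝ (Fin n) → ℝ)
    (ξ : EuclideanSpace ℂ (Fin n)) (w : EuclideanSpace ℝ (Fin n) → ℂ)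
    (x : EuclideanSpace ℝ (Fin n)) : ℂ :=
  Complex.exp ((∑ i, ξ i * (x i : ℂ)) - (s : ℂ) / 2 * (v₀ x : ℂ)) * (1 + w x)

end CGO

/-!
Conjugating by `e^{s v₀ / 2}` turns the equation for `m` into the Schrödinger equation
`Δu + P u = 0`, whose potential `P = q - (s / 2) Δv₀ - (s² / 4) |∇v₀|²` is bounded because `∇v₀` is
bounded together with its first derivatives. Writing `u = e^{ξ·x} (1 + ω)` with `ξ·ξ = 0`, what
remains is to solve `Δω + 2 ξ·∇ω = -P (1 + ω)` on `Ω` with a bound of order `|ξ|⁻¹`.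

This is done on a ball containing `Ω`, by Fourier series on a torus whose axes are chosen so that one
of them points along `Re ξ`, and with the frequencies shifted by half a lattice step along that axis.
The symbol `-|κ|² + 2 i ξ·κ` then has imaginary part of size at least a multiple of `|ξ|`
(`le_norm_cgoSymbol`), so that `Δ + 2 ξ·∇` has an `L²` inverse of norm `O(|ξ|⁻¹)`, and for large
`|ξ|` the potential is absorbed by a contraction (`exists_solution_on_ball`). The quadratic growth of
the symbol makes the inverse gain a derivative (`norm_freq_le`), whence `ω ∈ H¹`; weak derivatives
are computed term by term on the plane waves, against all `C¹` test functions, so no regularity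
theory is needed.

The way back multiplies by the weight `e^{ξ·x - s v₀ / 2}` (`weight_mul_solution`), which is only
`C²`: this is why the weak equation is tested with complex `C¹` functions of compact support.
The weight is bounded on `Ω` since a function with bounded gradient on a bounded Lipschitz domain is
bounded (`IsBoundedLipschitzDomain.exists_bound`).
-/

namespace CGO

open MeasureTheory Metric Set Filter Topology
open scoped ENNReal ComplexConjugate

/-! ### Balls inside a torus -/

section

/-- The Haar probability measure on the torus `(ℝ / ℤ)ⁿ`. -/
noncomputable abbrev torusMeasure (n : ℕ) : Measure (UnitAddTorus (Fin n)) :=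
  Measure.pi fun _ => AddCircle.haarAddCircle

/-- The Hilbert basis of Fourier monomials in `L²` of the torus. -/
noncomputable def torusBasis (n : ℕ) :
    HilbertBasis (Fin n → ℤ) ℂ (Lp ℂ 2 (torusMeasure n)) :=
  UnitAddTorus.mFourierBasis

lemma torusBasis_ae (n : ℕ) (k : Fin n → ℤ) :
    torusBasis n k =ᵐ[torusMeasure n] UnitAddTorus.mFourier k := by
  have h : torusBasis n k = UnitAddTorus.mFourierLp 2 k :=
    congrFun UnitAddTorus.coe_mFourierBasis k
  rw [h]
  exact UnitAddTorus.coeFn_mFourierLp 2 k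

/-- The coordinates of a point in an orthonormal basis `b`, in units of `l` and modulo `1`. -/
noncomputable def torusMap {n : ℕ} (b : OrthonormalBasis (Fin n) ℝ (EuclideanSpace ℝ (Fin n)))
    (l : ℝ) (x : EuclideanSpace ℝ (Fin n)) : UnitAddTorus (Fin n) :=
  fun i => ((b.repr x i / l : ℝ) : UnitAddCircle)

variable {n : ℕ} (b : OrthonormalBasis (Fin n) ℝ (EuclideanSpace ℝ (Fin n)))

lemma measurable_torusMap (l : ℝ) : Measurable (torusMap b l) := by
  refine measurable_pi_lambda _ fun i => AddCircle.measurable_mk'.comp ?_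
  exact Continuous.measurable (by fun_prop)

lemma coord_mem_Ioc {L : ℝ} (hL : 0 < L) {x : EuclideanSpace ℝ (Fin n)}
    (hx : x ∈ ball (0 : EuclideanSpace ℝ (Fin n)) L) (i : Fin n) :
    b.repr x i / (2 * L) ∈ Ioc (-1 / 2 : ℝ) (-1 / 2 + 1) := by
  have h1 : |b.repr x i| ≤ ‖x‖ := by
    have := PiLp.norm_apply_le (b.repr x) i
    rwa [b.repr.norm_map, Real.norm_eq_abs] at this
  rw [mem_ball_zero_iff] at hx
  have h2 := abs_lt.1 (h1.trans_lt hx)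
  constructor
  · rw [lt_div_iff₀ (by positivity)]; linarith
  · rw [div_le_iff₀ (by positivity)]; linarith

/-- Volume on the ball of radius `L` is dominated by Haar measure on the torus of side `2 L`. -/
lemma map_torusMap_le {L : ℝ} (hL : 0 < L) :
    (volume.restrict (ball (0 : EuclideanSpace ℝ (Fin n)) L)).map (torusMap b (2 * L)) ≤
      ENNReal.ofReal ((2 * L) ^ n) • torusMeasure n := by
  set A : EuclideanSpace ℝ (Fin n) → (Fin n → ℝ) := fun x => (2 * L)⁻¹ • WithLp.ofLp (b.repr x)
  have hAm : Measurable A := Continuous.measurable (by fun_prop)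
  have hA : (volume : Measure (EuclideanSpace ℝ (Fin n))).map A =
      ENNReal.ofReal ((2 * L) ^ n) • (volume : Measure (Fin n → ℝ)) := by
    have h1 : MeasurePreserving (fun x => WithLp.ofLp (b.repr x)) volume volume :=
      (PiLp.volume_preserving_ofLp (Fin n)).comp b.measurePreserving_repr
    have h2 : A = (fun y : Fin n → ℝ => (2 * L)⁻¹ • y) ∘ fun x => WithLp.ofLp (b.repr x) := rfl
    rw [h2, ← Measure.map_map (by fun_prop) h1.measurable, h1.map_eq,
      Measure.map_addHaar_smul _ (by positivity)]
    congr 2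
    rw [Module.finrank_fin_fun, inv_pow, inv_inv, abs_of_nonneg (by positivity)]
  set J : Set (Fin n → ℝ) := univ.pi fun _ => Ioc (-1 / 2 : ℝ) (-1 / 2 + 1)
  set M : (Fin n → ℝ) → UnitAddTorus (Fin n) := fun y i => (y i : UnitAddCircle)
  have hM : MeasurePreserving M (volume.restrict J) (torusMeasure n) := by
    have := measurePreserving_pi (fun _ : Fin n => volume.restrict (Ioc (-1 / 2 : ℝ) (-1 / 2 + 1)))
      (fun _ => (AddCircle.haarAddCircle : Measure UnitAddCircle))
      (f := fun _ (x : ℝ) => (x : UnitAddCircle)) (fun i => by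
        have := AddCircle.measurePreserving_mk 1 (-1 / 2)
        rwa [AddCircle.volume_eq_smul_haarAddCircle, ENNReal.ofReal_one, one_smul] at this)
    rwa [← Measure.restrict_pi_pi] at this
  refine Measure.le_iff.2 fun s hs => ?_
  rw [Measure.map_apply (measurable_torusMap b _) hs,
    Measure.restrict_apply (measurable_torusMap b _ hs), Measure.smul_apply,
    ← hM.measure_preimage hs.nullMeasurableSet, Measure.restrict_apply (hM.measurable hs)]
  rw [← Measure.smul_apply, ← hA, Measure.map_apply hAm
    ((hM.measurable hs).inter (MeasurableSet.univ_pi fun _ => measurableSet_Ioc))]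
  refine measure_mono fun x hx => ?_
  have hAx : ∀ i, A x i = b.repr x i / (2 * L) := fun i => by
    simp only [A, Pi.smul_apply, smul_eq_mul]; ring
  refine ⟨?_, fun i _ => ?_⟩
  · have : M (A x) = torusMap b (2 * L) x := by
      funext i; simp only [M, hAx, torusMap]
    simpa [this] using hx.1
  · rw [hAx]; exact coord_mem_Ioc b hL hx.2 i

/-- On a ball that the torus can hold, `torusMap` has a measurable left inverse. -/
lemma exists_torusMap_leftInverse {L : ℝ} (hL : 0 < L) :
    ∃ σ : UnitAddTorus (Fin n) → EuclideanSpace ℝ (Fin n), Measurable σ ∧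
      ∀ x ∈ ball (0 : EuclideanSpace ℝ (Fin n)) L, σ (torusMap b (2 * L) x) = x := by
  refine ⟨fun t => b.repr.symm (WithLp.toLp 2 fun i =>
    2 * L * (AddCircle.measurableEquivIoc 1 (-1 / 2) (t i)).1), ?_, fun x hx => ?_⟩
  · refine Measurable.comp (g := fun y : Fin n → ℝ => b.repr.symm (WithLp.toLp 2 y))
      (Continuous.measurable (by fun_prop)) ?_
    refine measurable_pi_lambda _ fun i => Measurable.const_mul ?_ _
    exact measurable_subtype_coe.comp
      ((AddCircle.measurableEquivIoc 1 (-1 / 2)).measurable.comp (measurable_pi_apply i))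
  · rw [LinearIsometryEquiv.symm_apply_eq]
    ext i
    have : AddCircle.measurableEquivIoc 1 (-1 / 2) (torusMap b (2 * L) x i) =
        ⟨b.repr x i / (2 * L), coord_mem_Ioc b hL hx i⟩ :=
      Subtype.ext (AddCircle.equivIoc_coe_of_mem (coord_mem_Ioc b hL hx i))
    simp only [this]
    field_simp

/-- Square-integrable functions on the torus pull back to square-integrable functions on the
ball. -/
lemma memLp_comp_torusMap {L : ℝ} (hL : 0 < L) {f : UnitAddTorus (Fin n) → ℂ}
    (hf : MemLp f 2 (torusMeasure n)) :
    MemLp (f ∘ torusMap b (2 * L)) 2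
      (volume.restrict (ball (0 : EuclideanSpace ℝ (Fin n)) L)) := by
  have h := hf.of_measure_le_smul (by simp) (map_torusMap_le b hL)
  exact h.comp_of_map (measurable_torusMap b _).aemeasurable

lemma eLpNorm_comp_torusMap_le {L : ℝ} (hL : 0 < L) {f : UnitAddTorus (Fin n) → ℂ}
    (hf : MemLp f 2 (torusMeasure n)) :
    eLpNorm (f ∘ torusMap b (2 * L)) 2
        (volume.restrict (ball (0 : EuclideanSpace ℝ (Fin n)) L)) ≤
      ENNReal.ofReal √((2 * L) ^ n) * eLpNorm f 2 (torusMeasure n) := by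
  have h := hf.of_measure_le_smul (by simp) (map_torusMap_le b hL)
  rw [← eLpNorm_map_measure h.1 (measurable_torusMap b _).aemeasurable]
  refine (eLpNorm_mono_measure f (map_torusMap_le b hL)).trans ?_
  rw [eLpNorm_smul_measure_of_ne_top (by simp), smul_eq_mul]
  refine le_of_eq (congrArg (· * _) ?_)
  rw [Real.sqrt_eq_rpow, ENNReal.ofReal_rpow_of_nonneg (by positivity) (by norm_num)]
  norm_num

/-- Almost everywhere statements on the torus pull back to the ball. -/
lemma ae_comp_torusMap {L : ℝ} (hL : 0 < L) {P : UnitAddTorus (Fin n) → Prop}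
    (h : ∀ᵐ t ∂torusMeasure n, P t) :
    ∀ᵐ x ∂volume.restrict (ball (0 : EuclideanSpace ℝ (Fin n)) L), P (torusMap b (2 * L) x) := by
  have h1 : (volume.restrict (ball (0 : EuclideanSpace ℝ (Fin n)) L)).map
      (torusMap b (2 * L)) ≪ torusMeasure n :=
    (Measure.absolutelyContinuous_of_le_smul (map_torusMap_le b hL))
  exact ae_of_ae_map (measurable_torusMap b _).aemeasurable (h1.ae_le h)

end

/-! ### Fourier multipliers and termwise integration -/

section

/-- A bounded sequence acts on a Hilbert space by multiplying coefficients in a Hilbert basis. -/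
lemma exists_multiplier {ι H : Type*} [NormedAddCommGroup H] [InnerProductSpace ℂ H]
    (e : HilbertBasis ι ℂ H) {m : ι → ℂ} {B : ℝ} (hB : 0 ≤ B) (hm : ∀ k, ‖m k‖ ≤ B) :
    ∃ G : H →L[ℂ] H, ‖G‖ ≤ B ∧ ∀ x k, e.repr (G x) k = m k * e.repr x k := by
  have hle : ∀ (f : lp (fun _ : ι => ℂ) 2) k, ‖m k * f k‖ ≤ ‖((B : ℂ) • f) k‖ := fun f k => by
    rw [norm_mul, lp.coeFn_smul, Pi.smul_apply, norm_smul, Complex.norm_real,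
      Real.norm_of_nonneg hB]
    exact mul_le_mul_of_nonneg_right (hm k) (norm_nonneg _)
  have hmem : ∀ f : lp (fun _ : ι => ℂ) 2, Memℓp (fun k => m k * f k) 2 := fun f => by
    have h := lp.memℓp ((B : ℂ) • f)
    rw [memℓp_gen_iff (by norm_num)] at h ⊢
    refine h.of_nonneg_of_le (fun k => by positivity) fun k => ?_
    exact Real.rpow_le_rpow (norm_nonneg _) (hle f k) (by norm_num)
  let T : lp (fun _ : ι => ℂ) 2 →ₗ[ℂ] lp (fun _ : ι => ℂ) 2 :=
    { toFun := fun f => ⟨fun k => m k * f k, hmem f⟩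
      map_add' := fun f g => by ext k; exact mul_add _ _ _
      map_smul' := fun c f => by ext k; exact mul_left_comm _ _ _ }
  have hT : ∀ f, ‖T f‖ ≤ B * ‖f‖ := fun f => by
    have h1 : ‖T f‖ ≤ ‖(B : ℂ) • f‖ := by
      refine lp.norm_le_of_forall_sum_le (by norm_num) (norm_nonneg _) fun s => ?_
      refine le_trans (Finset.sum_le_sum fun k _ => ?_)
        (lp.sum_rpow_le_norm_rpow (by norm_num) ((B : ℂ) • f) s)
      exact Real.rpow_le_rpow (norm_nonneg _) (hle f k) (by norm_num)
    rwa [norm_smul, Complex.norm_real, Real.norm_of_nonneg hB] at h1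
  refine ⟨(e.repr.symm.toContinuousLinearEquiv : _ →L[ℂ] H) ∘L T.mkContinuous B hT ∘L
    (e.repr.toContinuousLinearEquiv : H →L[ℂ] _), ?_, fun x k => ?_⟩
  · refine ContinuousLinearMap.opNorm_le_bound _ hB fun x => ?_
    have := hT (e.repr x)
    simpa using this
  · simp [T]

/-- Vectors with coefficients dominated by those of a given vector exist. -/
lemma exists_repr_eq_mul {ι H : Type*} [NormedAddCommGroup H] [InnerProductSpace ℂ H]
    (e : HilbertBasis ι ℂ H) {m : ι → ℂ} {B : ℝ} (hm : ∀ k, ‖m k‖ ≤ B) (x : H) :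
    ∃ y, ∀ k, e.repr y k = m k * e.repr x k := by
  obtain ⟨G, -, hG⟩ := exists_multiplier e (abs_nonneg B) fun k => (hm k).trans (le_abs_self B)
  exact ⟨G x, hG x⟩

lemma enorm_integral_mul_le {α : Type*} [MeasurableSpace α] {μ : Measure α} {f g : α → ℂ}
    (hf : AEStronglyMeasurable f μ) (hg : AEStronglyMeasurable g μ) :
    ‖∫ x, f x * g x ∂μ‖ₑ ≤ eLpNorm f 2 μ * eLpNorm g 2 μ := by
  refine (enorm_integral_le_lintegral_enorm _).trans ?_
  have h := eLpNorm_smul_le_mul_eLpNorm (p := 2) (q := 2) (r := 1) hg hf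
  rwa [eLpNorm_one_eq_lintegral_enorm] at h

variable {n : ℕ} (b : OrthonormalBasis (Fin n) ℝ (EuclideanSpace ℝ (Fin n)))

/-- Integrating a pulled back function against a fixed square-integrable function is a continuous
functional on `L²` of the torus, and may be computed termwise from the Fourier series. -/
lemma hasSum_integral_torusMap {L : ℝ} (hL : 0 < L) {ψ : EuclideanSpace ℝ (Fin n) → ℂ}
    (hψ : MemLp ψ 2 (volume.restrict (ball 0 L))) (W : Lp ℂ 2 (torusMeasure n)) :
    HasSum (fun k => (torusBasis n).repr W k *
        ∫ x in ball 0 L, UnitAddTorus.mFourier k (torusMap b (2 * L) x) * ψ x)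
      (∫ x in ball 0 L, W (torusMap b (2 * L) x) * ψ x) := by
  have hint : ∀ W : Lp ℂ 2 (torusMeasure n),
      Integrable (fun x => W (torusMap b (2 * L) x) * ψ x) (volume.restrict (ball 0 L)) :=
    fun W => (memLp_comp_torusMap b hL (Lp.memLp W)).integrable_mul hψ
  let Λ₀ : Lp ℂ 2 (torusMeasure n) →ₗ[ℂ] ℂ :=
    { toFun := fun W => ∫ x in ball 0 L, W (torusMap b (2 * L) x) * ψ x
      map_add' := fun W W' => by
        rw [← integral_add (hint W) (hint W')]
        refine integral_congr_ae ?_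
        filter_upwards [ae_comp_torusMap b hL (Lp.coeFn_add W W')] with x hx
        rw [hx, Pi.add_apply, add_mul]
      map_smul' := fun c W => by
        rw [RingHom.id_apply, smul_eq_mul, ← integral_const_mul]
        refine integral_congr_ae ?_
        filter_upwards [ae_comp_torusMap b hL (Lp.coeFn_smul c W)] with x hx
        rw [hx, Pi.smul_apply, smul_eq_mul, mul_assoc] }
  have hbound : ∀ W, ‖Λ₀ W‖ ≤
      (√((2 * L) ^ n) * (eLpNorm ψ 2 (volume.restrict (ball 0 L))).toReal) * ‖W‖ := fun W => by
    have h1 : ‖Λ₀ W‖ₑ ≤ eLpNorm (W ∘ torusMap b (2 * L)) 2 (volume.restrict (ball 0 L)) *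
        eLpNorm ψ 2 (volume.restrict (ball 0 L)) := by
      exact enorm_integral_mul_le (memLp_comp_torusMap b hL (Lp.memLp W)).1 hψ.1
    have h2 := h1.trans (mul_le_mul_left (eLpNorm_comp_torusMap_le b hL (Lp.memLp W)) _)
    have h3 := ENNReal.toReal_mono (ENNReal.mul_ne_top (ENNReal.mul_ne_top ENNReal.ofReal_ne_top
      (Lp.memLp W).2.ne) hψ.2.ne) h2
    rw [toReal_enorm, ENNReal.toReal_mul, ENNReal.toReal_mul,
      ENNReal.toReal_ofReal (Real.sqrt_nonneg _), ← Lp.norm_def] at h3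
    linarith
  have h := ((torusBasis n).hasSum_repr W).mapL (Λ₀.mkContinuous _ hbound)
  refine h.congr_fun ?_
  intro k
  rw [map_smul, smul_eq_mul, LinearMap.mkContinuous_apply]
  refine congrArg _ (integral_congr_ae ?_)
  filter_upwards [ae_comp_torusMap b hL (torusBasis_ae n k)] with x hx
  rw [hx]

end

/-! ### Plane waves and the symbol -/

section

variable {n : ℕ}

/-- Complex-valued `C¹` functions with compact support in `Ω`. Multiplying a test function by the
exponential prefactor of a CGO solution leads to this class, because `v₀` is only `C²`. -/
def IsC1TestFunction (Ω : Set (EuclideanSpace ℝ (Fin n))) (ψ : EuclideanSpace ℝ (Fin n) → ℂ) :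
    Prop :=
  ContDiff ℝ 1 ψ ∧ HasCompactSupport ψ ∧ tsupport ψ ⊆ Ω

/-- The `i`-th partial derivative of a complex function on `ℝⁿ`. -/
noncomputable def cpartialDeriv (i : Fin n) (ψ : EuclideanSpace ℝ (Fin n) → ℂ)
    (x : EuclideanSpace ℝ (Fin n)) : ℂ :=
  fderiv ℝ ψ x (EuclideanSpace.single i 1)

namespace IsC1TestFunction

variable {Ω : Set (EuclideanSpace ℝ (Fin n))} {ψ : EuclideanSpace ℝ (Fin n) → ℂ}

lemma mono {Ω' : Set (EuclideanSpace ℝ (Fin n))} (h : IsC1TestFunction Ω ψ) (hΩ : Ω ⊆ Ω') :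
    IsC1TestFunction Ω' ψ :=
  ⟨h.1, h.2.1, h.2.2.trans hΩ⟩

lemma continuous_cpartialDeriv (h : IsC1TestFunction Ω ψ) (i : Fin n) :
    Continuous (cpartialDeriv i ψ) :=
  (h.1.continuous_fderiv one_ne_zero).clm_apply continuous_const

lemma tsupport_cpartialDeriv (i : Fin n) :
    tsupport (cpartialDeriv i ψ) ⊆ tsupport ψ :=
  tsupport_fderiv_apply_subset ℝ _

lemma hasCompactSupport_cpartialDeriv (h : IsC1TestFunction Ω ψ) (i : Fin n) :
    HasCompactSupport (cpartialDeriv i ψ) :=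
  h.2.1.fderiv_apply ℝ _

lemma memLp (h : IsC1TestFunction Ω ψ) (p : ℝ≥0∞) (μ : Measure (EuclideanSpace ℝ (Fin n)))
    [IsFiniteMeasureOnCompacts μ] : MemLp ψ p μ :=
  h.1.continuous.memLp_of_hasCompactSupport h.2.1

lemma memLp_cpartialDeriv (h : IsC1TestFunction Ω ψ) (i : Fin n) (p : ℝ≥0∞)
    (μ : Measure (EuclideanSpace ℝ (Fin n))) [IsFiniteMeasureOnCompacts μ] :
    MemLp (cpartialDeriv i ψ) p μ :=
  (h.continuous_cpartialDeriv i).memLp_of_hasCompactSupport (h.hasCompactSupport_cpartialDeriv i)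

end IsC1TestFunction

lemma setIntegral_mul_eq_integral {Ω : Set (EuclideanSpace ℝ (Fin n))}
    {f ψ : EuclideanSpace ℝ (Fin n) → ℂ} (h : tsupport ψ ⊆ Ω) :
    ∫ x in Ω, f x * ψ x = ∫ x, f x * ψ x := by
  refine setIntegral_eq_integral_of_forall_compl_eq_zero fun x hx => ?_
  rw [image_eq_zero_of_notMem_tsupport fun hx' => hx (h hx'), mul_zero]

/-- The plane wave `x ↦ e^{i κ·x}`. -/
noncomputable def planeWave (κ x : EuclideanSpace ℝ (Fin n)) : ℂ :=
  Complex.exp ((inner ℝ κ x : ℝ) * Complex.I)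

lemma norm_planeWave (κ x : EuclideanSpace ℝ (Fin n)) : ‖planeWave κ x‖ = 1 :=
  Complex.norm_exp_ofReal_mul_I _

lemma planeWave_mul_conj (κ x : EuclideanSpace ℝ (Fin n)) :
    planeWave κ x * conj (planeWave κ x) = 1 := by
  rw [Complex.mul_conj, Complex.normSq_eq_norm_sq, norm_planeWave]; simp

lemma planeWave_add (κ κ' x : EuclideanSpace ℝ (Fin n)) :
    planeWave (κ + κ') x = planeWave κ x * planeWave κ' x := by
  simp only [planeWave, ← Complex.exp_add, inner_add_left, Complex.ofReal_add, add_mul]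

lemma contDiff_planeWave (κ : EuclideanSpace ℝ (Fin n)) : ContDiff ℝ 1 (planeWave κ) := by
  unfold planeWave
  exact Complex.contDiff_exp.comp ((Complex.ofRealCLM.contDiff.comp
    (contDiff_const.inner ℝ contDiff_id)).mul contDiff_const)

lemma continuous_planeWave (κ : EuclideanSpace ℝ (Fin n)) : Continuous (planeWave κ) :=
  (contDiff_planeWave κ).continuous

lemma cpartialDeriv_planeWave (κ x : EuclideanSpace ℝ (Fin n)) (i : Fin n) :
    cpartialDeriv i (planeWave κ) x = Complex.I * κ i * planeWave κ x := by
  have h1 : HasFDerivAt (fun x => (((inner ℝ κ x : ℝ) : ℂ) * Complex.I))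
      ((Complex.ofRealCLM ∘L innerSL ℝ κ).smulRight Complex.I) x :=
    ((Complex.ofRealCLM ∘L innerSL ℝ κ).hasFDerivAt (x := x)).mul_const' Complex.I
  have h2 := h1.cexp
  unfold cpartialDeriv
  have h3 : planeWave κ = fun x => Complex.exp ((inner ℝ κ x : ℝ) * Complex.I) := rfl
  rw [h3, h2.fderiv]
  simp [EuclideanSpace.inner_single_right]
  ring

/-- Plane waves are their own weak gradients up to the factor `i κ`. -/
lemma integral_planeWave_mul_cpartialDeriv {Ω : Set (EuclideanSpace ℝ (Fin n))}
    {ψ : EuclideanSpace ℝ (Fin n) → ℂ} (hψ : IsC1TestFunction Ω ψ)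
    (κ : EuclideanSpace ℝ (Fin n)) (i : Fin n) :
    ∫ x in Ω, planeWave κ x * cpartialDeriv i ψ x =
      -(Complex.I * κ i * ∫ x in Ω, planeWave κ x * ψ x) := by
  rw [setIntegral_mul_eq_integral
    ((IsC1TestFunction.tsupport_cpartialDeriv i).trans hψ.2.2),
    setIntegral_mul_eq_integral hψ.2.2, ← integral_const_mul]
  have hc := continuous_planeWave κ
  have hd : Continuous (cpartialDeriv i (planeWave κ)) := by
    rw [funext fun x => cpartialDeriv_planeWave κ x i]; fun_prop
  have := integral_mul_fderiv_eq_neg_fderiv_mul_of_integrable (μ := volume)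
    (f := planeWave κ) (g := ψ) (v := EuclideanSpace.single i (1 : ℝ))
    ((hd.mul hψ.1.continuous).integrable_of_hasCompactSupport hψ.2.1.mul_left)
    ((hc.mul (hψ.continuous_cpartialDeriv i)).integrable_of_hasCompactSupport
      (hψ.hasCompactSupport_cpartialDeriv i).mul_left)
    ((hc.mul hψ.1.continuous).integrable_of_hasCompactSupport hψ.2.1.mul_left)
    (fun x _ => (contDiff_planeWave κ).differentiable one_ne_zero x)
    (fun x _ => hψ.1.differentiable one_ne_zero x)
  refine this.trans (congrArg _ (integral_congr_ae (ae_of_all _ fun x => ?_)))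
  change cpartialDeriv i (planeWave κ) x * _ = _
  rw [cpartialDeriv_planeWave]; ring

/-- Half a lattice step in the direction `b i₀`. -/
noncomputable def halfStep (b : OrthonormalBasis (Fin n) ℝ (EuclideanSpace ℝ (Fin n)))
    (i₀ : Fin n) (l : ℝ) : EuclideanSpace ℝ (Fin n) :=
  (Real.pi / l) • b i₀

/-- The frequencies of the torus of side `l` in the coordinates `b`, shifted by half a step in the
direction `b i₀`. -/
noncomputable def shiftedFreq (b : OrthonormalBasis (Fin n) ℝ (EuclideanSpace ℝ (Fin n)))
    (i₀ : Fin n) (l : ℝ) (k : Fin n → ℤ) : EuclideanSpace ℝ (Fin n) :=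
  (2 * Real.pi / l) • ∑ i, (k i : ℝ) • b i + halfStep b i₀ l

variable (b : OrthonormalBasis (Fin n) ℝ (EuclideanSpace ℝ (Fin n))) (i₀ : Fin n)

lemma mFourier_torusMap (l : ℝ) (k : Fin n → ℤ) (x : EuclideanSpace ℝ (Fin n)) :
    planeWave (halfStep b i₀ l) x * UnitAddTorus.mFourier k (torusMap b l x) =
      planeWave (shiftedFreq b i₀ l k) x := by
  rw [shiftedFreq, planeWave_add, mul_comm]
  congr 1
  simp only [UnitAddTorus.mFourier, ContinuousMap.coe_mk, torusMap, fourier_coe_apply,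
    ← Complex.exp_sum, planeWave]
  congr 1
  rw [inner_smul_left, sum_inner, Complex.ofReal_mul, Complex.ofReal_sum, Finset.mul_sum,
    Finset.sum_mul]
  refine Finset.sum_congr rfl fun i _ => ?_
  rw [inner_smul_left, ← b.repr_apply_apply]
  push_cast
  simp
  ring

lemma inner_shiftedFreq (l : ℝ) (k : Fin n → ℤ) :
    inner ℝ (b i₀) (shiftedFreq b i₀ l k) = 2 * Real.pi / l * (k i₀ + 1 / 2) := by
  rw [shiftedFreq, halfStep, inner_add_right, inner_smul_right, inner_smul_right, inner_sum]
  simp_rw [inner_smul_right, b.inner_eq_ite]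
  simp
  ring

/-- The symbol of `Δ + 2 ξ·∇` at the frequency `κ`. -/
noncomputable def cgoSymbol (ξ : EuclideanSpace ℂ (Fin n)) (κ : EuclideanSpace ℝ (Fin n)) : ℂ :=
  ∑ j, (Complex.I * κ j + 2 * ξ j) * (Complex.I * κ j)

lemma cgoSymbol_eq (ξ : EuclideanSpace ℂ (Fin n)) (κ : EuclideanSpace ℝ (Fin n)) :
    cgoSymbol ξ κ = -((‖κ‖ ^ 2 : ℝ) : ℂ) + 2 * Complex.I * ∑ j, ξ j * κ j := by
  rw [EuclideanSpace.norm_sq_eq, Finset.mul_sum, Complex.ofReal_sum, ← Finset.sum_neg_distrib,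
    ← Finset.sum_add_distrib]
  refine Finset.sum_congr rfl fun j _ => ?_
  rw [Real.norm_eq_abs, sq_abs]
  push_cast
  linear_combination (κ j : ℂ) ^ 2 * Complex.I_sq

/-- The real part of a complex vector. -/
noncomputable def reVec (ξ : EuclideanSpace ℂ (Fin n)) : EuclideanSpace ℝ (Fin n) :=
  WithLp.toLp 2 fun i => (ξ i).re

lemma cgoSymbol_im (ξ : EuclideanSpace ℂ (Fin n)) (κ : EuclideanSpace ℝ (Fin n)) :
    (cgoSymbol ξ κ).im = 2 * inner ℝ (reVec ξ) κ := by
  rw [cgoSymbol_eq]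
  simp [reVec, PiLp.inner_apply, -Complex.ofReal_pow]
  exact Finset.sum_congr rfl fun j _ => mul_comm _ _

/-- The real and imaginary parts of a null vector have the same length. -/
lemma norm_sq_eq_two_mul_reVec {ξ : EuclideanSpace ℂ (Fin n)} (hξ : ∑ i, ξ i * ξ i = 0) :
    ‖ξ‖ ^ 2 = 2 * ‖reVec ξ‖ ^ 2 := by
  have h := congrArg Complex.re hξ
  simp only [Complex.re_sum, Complex.mul_re, Complex.zero_re, Finset.sum_sub_distrib] at h
  rw [EuclideanSpace.norm_sq_eq, EuclideanSpace.norm_sq_eq]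
  simp only [reVec, Real.norm_eq_abs, sq_abs, ← Complex.normSq_eq_norm_sq]
  simp only [Complex.normSq_apply, Finset.sum_add_distrib, pow_two]
  linarith

/-- If `b i₀` points along `Re ξ`, the imaginary part `2 Re ξ·κ` of the symbol is bounded below by a
multiple of `|ξ|`, because the coordinate of `κ` along `b i₀` is a nonzero half-integer multiple of
the lattice step. -/
lemma le_norm_cgoSymbol {ξ : EuclideanSpace ℂ (Fin n)} (hξ : ∑ i, ξ i * ξ i = 0)
    (hb : reVec ξ = ‖reVec ξ‖ • b i₀) {l : ℝ} (hl : 0 < l) (k : Fin n → ℤ) :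
    ‖ξ‖ / l ≤ ‖cgoSymbol ξ (shiftedFreq b i₀ l k)‖ := by
  have h1 : ‖ξ‖ ≤ 2 * ‖reVec ξ‖ := by
    have := norm_sq_eq_two_mul_reVec hξ
    exact abs_le_of_sq_le_sq' (by nlinarith [sq_nonneg ‖reVec ξ‖]) (by positivity) |>.2
  have h2 : (1 / 2 : ℝ) ≤ |(k i₀ : ℝ) + 1 / 2| := by
    rcases le_or_gt 0 (k i₀) with h | h
    · have : (0 : ℝ) ≤ k i₀ := by exact_mod_cast h
      rw [abs_of_nonneg (by linarith)]; linarith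
    · have : (k i₀ : ℝ) ≤ -1 := by exact_mod_cast Int.le_sub_one_of_lt h
      rw [abs_of_neg (by linarith)]; linarith
  refine le_trans ?_ (Complex.abs_im_le_norm _)
  rw [cgoSymbol_im, hb, inner_smul_left, inner_shiftedFreq]
  have h3 : |2 * ((starRingEnd ℝ) ‖reVec ξ‖ * (2 * Real.pi / l * ((k i₀ : ℝ) + 1 / 2)))| =
      4 * Real.pi * ‖reVec ξ‖ / l * |(k i₀ : ℝ) + 1 / 2| := by
    have : 2 * ((starRingEnd ℝ) ‖reVec ξ‖ * (2 * Real.pi / l * ((k i₀ : ℝ) + 1 / 2))) =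
      4 * Real.pi * ‖reVec ξ‖ / l * ((k i₀ : ℝ) + 1 / 2) := by
        simp only [conj_trivial]; ring
    rw [this, abs_mul, abs_of_nonneg (by positivity)]
  rw [h3]
  have h4 : 4 * Real.pi * ‖reVec ξ‖ / l * (1 / 2) ≤
      4 * Real.pi * ‖reVec ξ‖ / l * |(k i₀ : ℝ) + 1 / 2| :=
    mul_le_mul_of_nonneg_left h2 (by positivity)
  refine le_trans ?_ h4
  have h5 : 4 * Real.pi * ‖reVec ξ‖ / l * (1 / 2) = (2 * Real.pi * ‖reVec ξ‖) / l := by ring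
  rw [h5]
  gcongr
  nlinarith [Real.pi_gt_three, norm_nonneg (reVec ξ)]

/-- The quadratic growth of the symbol absorbs one derivative. -/
lemma norm_freq_le {ξ : EuclideanSpace ℂ (Fin n)} {κ : EuclideanSpace ℝ (Fin n)} {c : ℝ}
    (hc : 0 < c) (h : c ≤ ‖cgoSymbol ξ κ‖) :
    ‖κ‖ ≤ √(2 / c + 4 * ‖ξ‖ ^ 2 / c ^ 2) * ‖cgoSymbol ξ κ‖ := by
  set P := ‖cgoSymbol ξ κ‖
  have h1 : ‖∑ j, ξ j * (κ j : ℂ)‖ ≤ ‖ξ‖ * ‖κ‖ := by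
    refine (norm_sum_le _ _).trans ?_
    simp only [norm_mul, Complex.norm_real]
    rw [EuclideanSpace.norm_eq ξ, EuclideanSpace.norm_eq κ]
    exact Real.sum_mul_le_sqrt_mul_sqrt _ _ _
  have h2 : ‖κ‖ ^ 2 ≤ P + 2 * (‖ξ‖ * ‖κ‖) := by
    have h3 : ((‖κ‖ ^ 2 : ℝ) : ℂ) = -cgoSymbol ξ κ + 2 * Complex.I * ∑ j, ξ j * (κ j : ℂ) := by
      rw [cgoSymbol_eq]; ring
    have h4 := congrArg norm h3
    rw [Complex.norm_real, Real.norm_of_nonneg (by positivity)] at h4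
    rw [h4]
    refine (norm_add_le _ _).trans ?_
    rw [norm_neg, norm_mul]
    simp only [norm_mul, Complex.norm_I, Complex.norm_ofNat, mul_one]
    linarith
  have h5 : ‖κ‖ ^ 2 ≤ 2 * P + 4 * ‖ξ‖ ^ 2 := by nlinarith [sq_nonneg (‖κ‖ - 2 * ‖ξ‖)]
  have hP : 1 ≤ P / c := (one_le_div hc).2 h
  have h6 : ‖κ‖ ^ 2 ≤ (2 / c + 4 * ‖ξ‖ ^ 2 / c ^ 2) * P ^ 2 := by
    have e : (2 / c + 4 * ‖ξ‖ ^ 2 / c ^ 2) * P ^ 2 =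
        2 * P * (P / c) + 4 * ‖ξ‖ ^ 2 * (P / c) ^ 2 := by field_simp
    rw [e]
    have : 2 * P ≤ 2 * P * (P / c) := le_mul_of_one_le_right (by positivity) hP
    have : 4 * ‖ξ‖ ^ 2 ≤ 4 * ‖ξ‖ ^ 2 * (P / c) ^ 2 :=
      le_mul_of_one_le_right (by positivity) (one_le_pow₀ hP)
    linarith
  refine abs_le_of_sq_le_sq' ?_ (by positivity) |>.2
  rwa [mul_pow, Real.sq_sqrt (by positivity)]

/-- Termwise integration of a shifted Fourier series against a square-integrable function. -/
lemma hasSum_integral_shifted {L : ℝ} (hL : 0 < L) {ψ : EuclideanSpace ℝ (Fin n) → ℂ}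
    (hψ : MemLp ψ 2 (volume.restrict (ball 0 L))) (W : Lp ℂ 2 (torusMeasure n)) :
    HasSum (fun k => (torusBasis n).repr W k *
        ∫ x in ball 0 L, planeWave (shiftedFreq b i₀ (2 * L) k) x * ψ x)
      (∫ x in ball 0 L, planeWave (halfStep b i₀ (2 * L)) x * W (torusMap b (2 * L) x) * ψ x) := by
  have hψ' : MemLp (fun x => planeWave (halfStep b i₀ (2 * L)) x * ψ x) 2
      (volume.restrict (ball 0 L)) := by
    refine hψ.of_le ((continuous_planeWave _).aestronglyMeasurable.mul hψ.1)
      (ae_of_all _ fun x => ?_)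
    rw [norm_mul, norm_planeWave, one_mul]
  have h := hasSum_integral_torusMap b hL hψ' W
  convert h using 3 with k
  · refine integral_congr_ae (ae_of_all _ fun x => ?_)
    simp only [← mFourier_torusMap]; ring
  · ring

end

/-! ### Solvability on a ball -/

section

variable {n : ℕ}

lemma exists_orthonormalBasis_reVec {ξ : EuclideanSpace ℂ (Fin n)} (hξ : reVec ξ ≠ 0) :
    ∃ (b : OrthonormalBasis (Fin n) ℝ (EuclideanSpace ℝ (Fin n))) (i₀ : Fin n),
      reVec ξ = ‖reVec ξ‖ • b i₀ := by
  obtain ⟨i₀, -⟩ : ∃ i, reVec ξ i ≠ 0 := by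
    by_contra! h
    exact hξ (by ext i; exact h i)
  have hv : Orthonormal ℝ (({i₀} : Set (Fin n)).domRestrict fun _ => ‖reVec ξ‖⁻¹ • reVec ξ) := by
    refine ⟨fun i => ?_, fun i j hij => absurd (Subsingleton.elim i j) hij⟩
    simp [domRestrict, norm_smul, norm_ne_zero_iff.2 hξ]
  obtain ⟨b, hb⟩ := hv.exists_orthonormalBasis_extension_of_card_eq (by simp)
  refine ⟨b, i₀, ?_⟩
  rw [hb i₀ rfl, smul_smul, mul_inv_cancel₀ (norm_ne_zero_iff.2 hξ), one_smul]

/-- Multiplication by a bounded function on `L²`. -/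
lemma exists_mulL {α : Type*} [MeasurableSpace α] {μ : Measure α} {f : α → ℂ} {K : ℝ}
    (hK : 0 ≤ K) (hf : Measurable f) (hfK : ∀ t, ‖f t‖ ≤ K) :
    ∃ T : Lp ℂ 2 μ →L[ℂ] Lp ℂ 2 μ, ‖T‖ ≤ K ∧ ∀ W, T W =ᵐ[μ] fun t => f t * W t := by
  have hm : ∀ W : Lp ℂ 2 μ, MemLp (fun t => f t * W t) 2 μ := fun W =>
    (Lp.memLp W).of_le_mul (hf.aestronglyMeasurable.mul (Lp.memLp W).1)
      (ae_of_all _ fun t => by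
        rw [norm_mul]; exact mul_le_mul_of_nonneg_right (hfK t) (norm_nonneg _))
  let T : Lp ℂ 2 μ →ₗ[ℂ] Lp ℂ 2 μ :=
    { toFun := fun W => (hm W).toLp
      map_add' := fun W W' => by
        rw [← MemLp.toLp_add]
        refine MemLp.toLp_congr _ _ ?_
        filter_upwards [Lp.coeFn_add W W'] with t ht
        rw [ht, Pi.add_apply, Pi.add_apply, mul_add]
      map_smul' := fun c W => by
        rw [RingHom.id_apply, ← MemLp.toLp_const_smul]
        refine MemLp.toLp_congr _ _ ?_
        filter_upwards [Lp.coeFn_smul c W] with t ht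
        rw [ht, Pi.smul_apply, Pi.smul_apply, smul_eq_mul, smul_eq_mul, mul_left_comm] }
  have hT : ∀ W, T W =ᵐ[μ] fun t => f t * W t := fun W => (hm W).coeFn_toLp
  refine ⟨T.mkContinuous K fun W => ?_, T.mkContinuous_norm_le hK _, hT⟩
  refine Lp.norm_le_mul_norm_of_ae_le_mul ?_
  filter_upwards [hT W] with t ht
  rw [ht, norm_mul]
  exact mul_le_mul_of_nonneg_right (hfK t) (norm_nonneg _)

/-- A contraction argument: a small affine perturbation of the identity has a solution, bounded by
twice its data. -/
lemma exists_eq_clm_add {H : Type*} [NormedAddCommGroup H] [NormedSpace ℂ H] [CompleteSpace H]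
    (A : H →L[ℂ] H) (hA : ‖A‖ ≤ 1 / 2) (y : H) : ∃ w, w = A (y + w) ∧ ‖w‖ ≤ 2 * (‖A‖ * ‖y‖) := by
  have hc : ContractingWith (1 / 2) fun w => A (y + w) := by
    refine ⟨by rw [← NNReal.coe_lt_coe]; norm_num, LipschitzWith.of_dist_le_mul fun w w' => ?_⟩
    rw [dist_eq_norm, dist_eq_norm, ← map_sub, add_sub_add_left_eq_sub]
    refine (A.le_opNorm _).trans (mul_le_mul_of_nonneg_right ?_ (norm_nonneg _))
    simpa using hA
  have hw := hc.fixedPoint_isFixedPt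
  set w := hc.fixedPoint
  have hw' : w = A (y + w) := hw.symm
  refine ⟨w, hw', ?_⟩
  have h1 : ‖w‖ ≤ ‖A‖ * ‖y‖ + ‖A‖ * ‖w‖ := by
    conv_lhs => rw [hw']
    refine (A.le_opNorm _).trans ?_
    rw [← mul_add]
    exact mul_le_mul_of_nonneg_left (norm_add_le _ _) (norm_nonneg _)
  nlinarith [norm_nonneg w]

set_option maxHeartbeats 400000 in
/-- Solvability of `Δω + 2 ξ·∇ω + Q (1 + ω) = 0` on a ball, with the decay `O(|ξ|⁻¹)` uniform over
potentials bounded by `K`. -/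
lemma exists_solution_on_ball {L : ℝ} (hL : 0 < L) {K : ℝ} (hK : 0 ≤ K) :
    ∃ C R : ℝ, 0 < C ∧ 0 < R ∧ ∀ ξ : EuclideanSpace ℂ (Fin n), ∑ i, ξ i * ξ i = 0 → R ≤ ‖ξ‖ →
      ∀ Q : EuclideanSpace ℝ (Fin n) → ℂ, Measurable Q → (∀ x, ‖Q x‖ ≤ K) →
      ∃ (ω : EuclideanSpace ℝ (Fin n) → ℂ) (g : Fin n → EuclideanSpace ℝ (Fin n) → ℂ),
        MemLp ω 2 (volume.restrict (ball 0 L)) ∧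
        (∀ i, MemLp (g i) 2 (volume.restrict (ball 0 L))) ∧
        (∀ ψ, IsC1TestFunction (ball 0 L) ψ → ∀ i,
          ∫ x in ball 0 L, ω x * cpartialDeriv i ψ x = -∫ x in ball 0 L, g i x * ψ x) ∧
        (∀ ψ, IsC1TestFunction (ball 0 L) ψ →
          -(∑ i, ∫ x in ball 0 L, g i x * cpartialDeriv i ψ x)
            + 2 * (∑ i, ξ i * ∫ x in ball 0 L, g i x * ψ x)
            + ∫ x in ball 0 L, Q x * (1 + ω x) * ψ x = 0) ∧
        eLpNorm ω 2 (volume.restrict (ball 0 L)) ≤ ENNReal.ofReal (C * ‖ξ‖⁻¹) := by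
  refine ⟨√((2 * L) ^ n) * (2 * (2 * L * K)) + 1, 4 * L * K + 1, by positivity, by positivity,
    fun ξ hξ hR Q hQm hQK => ?_⟩
  have hξ0 : 0 < ‖ξ‖ := lt_of_lt_of_le (by positivity) hR
  have hre : reVec ξ ≠ 0 := fun h => by
    have := norm_sq_eq_two_mul_reVec hξ
    rw [h, norm_zero] at this
    nlinarith
  obtain ⟨b, i₀, hb⟩ := exists_orthonormalBasis_reVec hre
  have hl : 0 < 2 * L := by positivity
  set l := 2 * L with hldef
  set κ := shiftedFreq b i₀ l with hκ
  set p : (Fin n → ℤ) → ℂ := fun k => cgoSymbol ξ (κ k) with hp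
  have hpc : ∀ k, ‖ξ‖ / l ≤ ‖p k‖ := le_norm_cgoSymbol b i₀ hξ hb hl
  have hc : 0 < ‖ξ‖ / l := by positivity
  have hp0 : ∀ k, p k ≠ 0 := fun k => norm_pos_iff.1 (hc.trans_le (hpc k))
  obtain ⟨σ, hσm, hσ⟩ := exists_torusMap_leftInverse b hL
  set sh := planeWave (halfStep b i₀ l) with hsh
  -- the inverse of the differential operator, as a Fourier multiplier
  obtain ⟨G, hG, hGr⟩ := exists_multiplier (torusBasis n) (m := fun k => (p k)⁻¹)
    (B := l / ‖ξ‖) (by positivity) fun k => by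
      rw [norm_inv, ← inv_div]; exact inv_anti₀ hc (hpc k)
  -- multiplication by the potential, transported to the torus
  obtain ⟨T, hT, hTae⟩ := exists_mulL (μ := torusMeasure n) hK (hQm.comp hσm)
    fun t => hQK (σ t)
  -- the constant function `1`, with the half-step phase divided out, transported to the torus
  have hSm : MemLp (fun t => conj (sh (σ t))) 2 (torusMeasure n) := by
    refine MemLp.of_bound (C := 1) ?_ (ae_of_all _ fun t => ?_)
    · exact ((Complex.continuous_conj.comp (continuous_planeWave _)).measurable.comp
        hσm).aestronglyMeasurable
    · rw [RCLike.norm_conj, hsh, norm_planeWave]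
  set S := hSm.toLp with hS
  have hSn : ‖S‖ ≤ 1 := by
    refine (Lp.norm_le_of_ae_bound (C := 1) zero_le_one ?_).trans ?_
    · filter_upwards [hSm.coeFn_toLp] with t ht
      rw [hS, ht, RCLike.norm_conj, hsh, norm_planeWave]
    · simp [measureUnivNNReal]
  set A : Lp ℂ 2 (torusMeasure n) →L[ℂ] Lp ℂ 2 (torusMeasure n) := -(G ∘L T) with hA
  have hAn : ‖A‖ ≤ l / ‖ξ‖ * K := by
    rw [hA, norm_neg]
    exact (ContinuousLinearMap.opNorm_comp_le _ _).trans
      (mul_le_mul hG hT (norm_nonneg _) (by positivity))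
  have hA2 : ‖A‖ ≤ 1 / 2 := by
    refine hAn.trans ?_
    rw [div_mul_eq_mul_div, div_le_iff₀ hξ0, hldef]
    linarith
  obtain ⟨W, hW, hWn⟩ := exists_eq_clm_add A hA2 S
  set H : Lp ℂ 2 (torusMeasure n) := -T (S + W) with hH
  have hWG : W = G H := by
    conv_lhs => rw [hW]
    simp [hH, hA]
  have hWr : ∀ k, (torusBasis n).repr W k = (p k)⁻¹ * (torusBasis n).repr H k := fun k => by
    rw [← hGr, ← hWG]
  have hV : ∀ j, ∃ V, ∀ k, (torusBasis n).repr V k =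
      (Complex.I * κ k j * (p k)⁻¹) * (torusBasis n).repr H k := fun j => by
    refine exists_repr_eq_mul (torusBasis n)
      (B := √(2 / (‖ξ‖ / l) + 4 * ‖ξ‖ ^ 2 / (‖ξ‖ / l) ^ 2)) (fun k => ?_) H
    rw [norm_mul, norm_mul, norm_inv, Complex.norm_I, one_mul, Complex.norm_real,
      ← div_eq_mul_inv, div_le_iff₀ (norm_pos_iff.2 (hp0 k))]
    exact (PiLp.norm_apply_le (κ k) j).trans (norm_freq_le hc (hpc k))
  choose V hVr using hV
  have hmem : ∀ U : Lp ℂ 2 (torusMeasure n),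
      MemLp (fun x => sh x * U (torusMap b l x)) 2 (volume.restrict (ball 0 L)) := fun U => by
    refine (memLp_comp_torusMap b hL (Lp.memLp U)).of_le
      ((continuous_planeWave _).aestronglyMeasurable.mul
        (memLp_comp_torusMap b hL (Lp.memLp U)).1) (ae_of_all _ fun x => ?_)
    rw [norm_mul, hsh, norm_planeWave, one_mul]; rfl
  have hsum := fun ψ hψ => hasSum_integral_shifted b i₀ hL (ψ := ψ) hψ
  refine ⟨fun x => sh x * W (torusMap b l x), fun j x => sh x * V j (torusMap b l x), hmem W,
    fun j => hmem (V j), fun ψ hψ j => ?_, fun ψ hψ => ?_, ?_⟩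
  · have h1 := hsum _ (hψ.memLp_cpartialDeriv j 2 _) W
    have h2 := (hsum _ (hψ.memLp 2 _) (V j)).neg
    refine h1.unique (h2.congr_fun fun k => ?_)
    rw [integral_planeWave_mul_cpartialDeriv hψ, hVr, hWr]
    ring
  · have h1 := (hasSum_sum fun j (_ : j ∈ Finset.univ) =>
      hsum _ (hψ.memLp_cpartialDeriv j 2 _) (V j)).neg
    have h2 := (hasSum_sum fun j (_ : j ∈ Finset.univ) =>
      (hsum _ (hψ.memLp 2 _) (V j)).mul_left (ξ j)).mul_left 2
    have h3 := hsum _ (hψ.memLp 2 _) H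
    have h4 := (h1.add h2).unique (h3.congr_fun fun k => ?_)
    · refine (congrArg (· + _) h4).trans ?_
      rw [← integral_add]
      · refine integral_eq_zero_of_ae ?_
        have hHae : ∀ᵐ t ∂torusMeasure n, H t = -(Q (σ t) * (conj (sh (σ t)) + W t)) := by
          filter_upwards [Lp.coeFn_neg (T (S + W)), hTae (S + W), Lp.coeFn_add S W,
            hSm.coeFn_toLp] with t e1 e2 e3 e4
          rw [hH, e1, Pi.neg_apply, e2, e3, Pi.add_apply, hS, e4]; rfl
        filter_upwards [ae_comp_torusMap b hL hHae, ae_restrict_mem measurableSet_ball]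
          with x hx hxB
        rw [hx, hσ x hxB, Pi.zero_apply]
        linear_combination -(Q x * ψ x) * planeWave_mul_conj (halfStep b i₀ l) x
      · exact (hmem H).integrable_mul (hψ.memLp 2 _)
      · refine MemLp.integrable_mul (p := 2) (q := 2) ?_ (hψ.memLp 2 _)
        have : IsFiniteMeasure (volume.restrict (ball (0 : EuclideanSpace ℝ (Fin n)) L)) :=
          isFiniteMeasure_restrict.2 measure_ball_lt_top.ne
        have h5 : MemLp (fun x => 1 + sh x * W (torusMap b l x)) 2
            (volume.restrict (ball 0 L)) :=
          MemLp.add (f := fun _ => (1 : ℂ)) (memLp_const 1) (hmem W)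
        refine h5.of_le_mul (c := K) (hQm.aestronglyMeasurable.mul h5.1)
          (ae_of_all _ fun x => ?_)
        rw [norm_mul]
        exact mul_le_mul_of_nonneg_right (hQK x) (norm_nonneg _)
    · simp only [integral_planeWave_mul_cpartialDeriv hψ, hVr]
      rw [← Finset.sum_neg_distrib, Finset.mul_sum, ← Finset.sum_add_distrib]
      set J := ∫ x in ball 0 L, planeWave (shiftedFreq b i₀ (2 * L) k) x * ψ x
      set c := (torusBasis n).repr H k
      have hpk : p k * (p k)⁻¹ = 1 := mul_inv_cancel₀ (hp0 k)
      rw [show shiftedFreq b i₀ (2 * L) k = κ k from rfl]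
      generalize (p k)⁻¹ = r at hpk ⊢
      refine Eq.trans ?_ (show p k * (r * (c * J)) = c * J by rw [← mul_assoc, hpk, one_mul])
      rw [show p k = cgoSymbol ξ (κ k) from rfl, cgoSymbol, Finset.sum_mul]
      refine Finset.sum_congr rfl fun j _ => ?_
      ring
  · have h1 : eLpNorm (fun x => sh x * W (torusMap b l x)) 2 (volume.restrict (ball 0 L)) ≤
        eLpNorm (W ∘ torusMap b l) 2 (volume.restrict (ball 0 L)) := by
      refine eLpNorm_mono fun x => ?_
      rw [norm_mul, hsh, norm_planeWave, one_mul]; rfl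
    refine (h1.trans (eLpNorm_comp_torusMap_le b hL (Lp.memLp W))).trans ?_
    rw [← ENNReal.ofReal_toReal (Lp.memLp W).2.ne, ← Lp.norm_def,
      ← ENNReal.ofReal_mul (Real.sqrt_nonneg _)]
    refine ENNReal.ofReal_le_ofReal ?_
    have h2 : ‖W‖ ≤ 2 * (l / ‖ξ‖ * K) := by
      refine hWn.trans (mul_le_mul_of_nonneg_left ?_ zero_le_two)
      calc ‖A‖ * ‖S‖ ≤ ‖A‖ * 1 := mul_le_mul_of_nonneg_left hSn (norm_nonneg _)
        _ ≤ _ := by rw [mul_one]; exact hAn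
    calc √((2 * L) ^ n) * ‖W‖ ≤ √((2 * L) ^ n) * (2 * (l / ‖ξ‖ * K)) :=
          mul_le_mul_of_nonneg_left h2 (Real.sqrt_nonneg _)
      _ = √((2 * L) ^ n) * (2 * (2 * L * K)) * ‖ξ‖⁻¹ := by rw [hldef]; ring
      _ ≤ _ := mul_le_mul_of_nonneg_right (by linarith) (by positivity)

end

/-! ### Bounded functions on Lipschitz domains -/

section

variable {n : ℕ}

lemma fderiv_eq_sum_partialDeriv (f : EuclideanSpace ℝ (Fin n) → ℝ)
    (x y : EuclideanSpace ℝ (Fin n)) : fderiv ℝ f x y = ∑ i, y i * partialDeriv i f x := by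
  have hy : y = ∑ i, y i • EuclideanSpace.single i (1 : ℝ) := by
    have := (EuclideanSpace.basisFun (Fin n) ℝ).sum_repr y
    simpa using this.symm
  conv_lhs => rw [hy]
  simp [map_sum, partialDeriv]

/-- On a bounded domain lying locally above a Lipschitz graph, a function with bounded gradient is
bounded: moving a fixed distance in the vertical direction takes the points of the domain near a
boundary point, along segments inside the domain, to a neighbourhood of an interior point. -/
lemma IsBoundedLipschitzDomain.exists_bound {Ω : Set (EuclideanSpace ℝ (Fin n))}
    (hΩ : IsBoundedLipschitzDomain Ω) {v : EuclideanSpace ℝ (Fin n) → ℝ}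
    (hv : DifferentiableOn ℝ v Ω) {M : ℝ} (hM : ∀ x ∈ Ω, ∀ i, |partialDeriv i v x| ≤ M) :
    ∃ K : ℝ, ∀ x ∈ Ω, |v x| ≤ K := by
  have hvc : ∀ z ∈ Ω, ∃ K : ℝ, ∀ᶠ y in 𝓝 z, |v y| ≤ K := fun z hz => by
    have hc : ContinuousAt (fun y => |v y|) z :=
      ((hv z hz).differentiableAt (hΩ.isOpen.mem_nhds hz)).continuousAt.abs
    exact ⟨|v z| + 1, (hc.eventually (gt_mem_nhds (lt_add_one |v z|))).mono fun _ h => h.le⟩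
  have hmain : ∃ K : ℝ, ∀ x ∈ closure Ω ∩ Ω, |v x| ≤ K := by
    refine hΩ.isBounded.isCompact_closure.induction_on
      (p := fun s => ∃ K : ℝ, ∀ x ∈ s ∩ Ω, |v x| ≤ K) ⟨0, by simp⟩ ?_ ?_ fun p hp => ?_
    · rintro s t hst ⟨K, hK⟩
      exact ⟨K, fun x hx => hK x ⟨hst hx.1, hx.2⟩⟩
    · rintro s t ⟨K, hK⟩ ⟨K', hK'⟩
      refine ⟨max K K', ?_⟩
      rintro x ⟨hx | hx, hxΩ⟩
      · exact (hK x ⟨hx, hxΩ⟩).trans (le_max_left _ _)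
      · exact (hK' x ⟨hx, hxΩ⟩).trans (le_max_right _ _)
    by_cases hpΩ : p ∈ Ω
    · obtain ⟨K, hK⟩ := hvc p hpΩ
      exact ⟨_, mem_nhdsWithin_of_mem_nhds hK, K, fun x hx => hx.1⟩
    obtain ⟨e, γ, Kγ, r, he, hγ, hr, hgraph⟩ := hΩ.lipschitz_boundary p
      (by rw [hΩ.isOpen.frontier_eq]; exact ⟨hp, hpΩ⟩)
    have hvert : ∀ (x : EuclideanSpace ℝ (Fin n)) (t : ℝ),
        inner ℝ e (x + t • e) = inner ℝ e x + t ∧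
        x + t • e - (inner ℝ e (x + t • e) : ℝ) • e = x - (inner ℝ e x : ℝ) • e := fun x t => by
      have h1 : inner ℝ e (x + t • e) = inner ℝ e x + t := by
        rw [inner_add_right, inner_smul_right, real_inner_self_eq_norm_sq, he]; ring
      refine ⟨h1, ?_⟩
      rw [h1, add_smul]; abel
    -- as a limit of points of `Ω`, the boundary point lies on or above the graph
    have hpγ : γ (p - (inner ℝ e p : ℝ) • e) ≤ inner ℝ e p := by
      by_contra! hlt
      have hopen : ∀ᶠ y in 𝓝 p, inner ℝ e y < γ (y - (inner ℝ e y : ℝ) • e) := by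
        have h1 : Continuous fun y : EuclideanSpace ℝ (Fin n) => (inner ℝ e y : ℝ) := by fun_prop
        have h2 : Continuous fun y : EuclideanSpace ℝ (Fin n) =>
            γ (y - (inner ℝ e y : ℝ) • e) := hγ.continuous.comp (by fun_prop)
        exact h1.continuousAt.eventually_lt h2.continuousAt hlt
      obtain ⟨y, hy, hyΩ⟩ := mem_closure_iff_nhds.1 hp _ (hopen.and (ball_mem_nhds p hr))
      exact lt_asymm hy.1 ((hgraph y hy.2).1 hyΩ)
    have hδ : 0 < r / 4 := by positivity
    have hmove : ∀ (x : EuclideanSpace ℝ (Fin n)), x ∈ ball p (r / 2) → ∀ t ∈ Icc (0 : ℝ) (r / 4),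
        x + t • e ∈ ball p r := fun x hx t ht => by
      rw [mem_ball_iff_norm] at hx ⊢
      have : x + t • e - p = (x - p) + t • e := by abel
      rw [this]
      refine (norm_add_le _ _).trans_lt ?_
      rw [norm_smul, he, mul_one, Real.norm_of_nonneg ht.1]
      linarith [ht.2]
    have hz : p + (r / 4) • e ∈ Ω := by
      rw [hgraph _ (hmove p (mem_ball_self (by positivity)) _ ⟨hδ.le, le_rfl⟩),
        (hvert p _).2, (hvert p _).1]
      linarith
    obtain ⟨K, hK⟩ := hvc _ hz
    have hcont : ContinuousAt (fun x : EuclideanSpace ℝ (Fin n) => x + (r / 4) • e) p := by fun_prop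
    refine ⟨_, mem_nhdsWithin_of_mem_nhds (inter_mem (hcont.eventually hK)
      (ball_mem_nhds p (half_pos hr))), K + n * M * (r / 4), ?_⟩
    rintro x ⟨⟨hxK, hxb⟩, hxΩ⟩
    have hxb' : x ∈ ball p r := ball_subset_ball (by linarith) hxb
    have hseg : ∀ t ∈ Icc (0 : ℝ) (r / 4), x + t • e ∈ Ω := fun t ht => by
      rw [hgraph _ (hmove x hxb t ht), (hvert x t).2, (hvert x t).1]
      linarith [(hgraph x hxb').1 hxΩ, ht.1]
    have hder : ∀ t ∈ Icc (0 : ℝ) (r / 4),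
        HasDerivWithinAt (fun t : ℝ => v (x + t • e)) (fderiv ℝ v (x + t • e) e)
          (Icc 0 (r / 4)) t := fun t ht => by
      have h1 : HasDerivAt (fun t : ℝ => x + t • e) e t := by
        simpa using ((hasDerivAt_id t).smul_const e).const_add x
      exact ((((hv _ (hseg t ht)).differentiableAt
        (hΩ.isOpen.mem_nhds (hseg t ht))).hasFDerivAt).comp_hasDerivAt t h1).hasDerivWithinAt
    have hbd : ∀ t ∈ Ico (0 : ℝ) (r / 4), ‖fderiv ℝ v (x + t • e) e‖ ≤ n * M := fun t ht => by
      rw [fderiv_eq_sum_partialDeriv]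
      refine (norm_sum_le _ _).trans ?_
      refine (Finset.sum_le_card_nsmul _ _ M fun i _ => ?_).trans (by simp)
      rw [norm_mul]
      have h1 : ‖e i‖ ≤ 1 := (PiLp.norm_apply_le e i).trans he.le
      exact (mul_le_of_le_one_left (norm_nonneg _) h1).trans (hM _ (hseg t ⟨ht.1, ht.2.le⟩) i)
    have h := norm_image_sub_le_of_norm_deriv_le_segment' hder hbd (r / 4) ⟨hδ.le, le_rfl⟩
    rw [zero_smul, add_zero, Real.norm_eq_abs, sub_zero] at h
    have h1 : |v (x + (r / 4) • e)| ≤ K := hxK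
    have h2 : |v x| ≤ |v (x + (r / 4) • e)| + |v (x + (r / 4) • e) - v x| := by
      have := abs_sub (v (x + (r / 4) • e)) (v (x + (r / 4) • e) - v x)
      rwa [sub_sub_cancel] at this
    linarith
  obtain ⟨K, hK⟩ := hmain
  exact ⟨K, fun x hx => hK x ⟨subset_closure hx, hx⟩⟩

/-- An essentially bounded function has a measurable version that is bounded everywhere. -/
lemma exists_bounded_version {α : Type*} [MeasurableSpace α] {μ : Measure α} {f : α → ℂ}
    (hf : MemLp f ⊤ μ) :
    ∃ (K : ℝ) (Q : α → ℂ), 0 ≤ K ∧ Measurable Q ∧ (∀ x, ‖Q x‖ ≤ K) ∧ Q =ᵐ[μ] f := by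
  obtain ⟨g, hg, hfg⟩ := hf.1
  set K := (eLpNorm f ⊤ μ).toReal
  have hs : MeasurableSet {x | ‖g x‖ ≤ K} := measurableSet_le hg.measurable.norm measurable_const
  refine ⟨K, indicator {x | ‖g x‖ ≤ K} g, ENNReal.toReal_nonneg, hg.measurable.indicator hs,
    fun x => ?_, ?_⟩
  · by_cases hx : ‖g x‖ ≤ K
    · rwa [indicator_of_mem (s := {x | ‖g x‖ ≤ K}) hx]
    · rw [indicator_of_notMem (s := {x | ‖g x‖ ≤ K}) hx, norm_zero]
      exact ENNReal.toReal_nonneg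
  · have hb := ae_le_eLpNormEssSup (f := f) (μ := μ)
    filter_upwards [hfg, hb] with x hx hxb
    have : ‖g x‖ ≤ K := by
      rw [← hx, ← toReal_enorm]
      exact ENNReal.toReal_mono hf.2.ne (by rwa [eLpNorm_exponent_top])
    rw [indicator_of_mem (s := {x | ‖g x‖ ≤ K}) this, hx]

lemma memLp_top_of_continuousOn {Ω : Set (EuclideanSpace ℝ (Fin n))} (hΩ : IsOpen Ω)
    {f : EuclideanSpace ℝ (Fin n) → ℂ} (hf : ContinuousOn f Ω) {M : ℝ}
    (hM : ∀ x ∈ Ω, ‖f x‖ ≤ M) : MemLp f ⊤ (volume.restrict Ω) :=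
  memLp_top_of_bound (hf.aestronglyMeasurable hΩ.measurableSet) M
    ((ae_restrict_mem hΩ.measurableSet).mono hM)

end

/-! ### Changing the dependent variable -/

section

variable {n : ℕ} {Ω : Set (EuclideanSpace ℝ (Fin n))}

lemma IsC1TestFunction.mul (hΩ : IsOpen Ω) {f ψ : EuclideanSpace ℝ (Fin n) → ℂ}
    (hψ : IsC1TestFunction Ω ψ) (hf : ContDiffOn ℝ 1 f Ω) :
    IsC1TestFunction Ω (fun x => f x * ψ x) := by
  have hsub : tsupport (fun x => f x * ψ x) ⊆ tsupport ψ := tsupport_mul_subset_right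
  refine ⟨contDiff_iff_contDiffAt.2 fun x => ?_, hψ.2.1.mul_left, hsub.trans hψ.2.2⟩
  by_cases hx : x ∈ tsupport ψ
  · exact (hf.contDiffAt (hΩ.mem_nhds (hψ.2.2 hx))).mul hψ.1.contDiffAt
  · exact contDiffAt_const.congr_of_eventuallyEq
      (notMem_tsupport_iff_eventuallyEq.1 fun h => hx (hsub h))

lemma cpartialDeriv_mul {f ψ : EuclideanSpace ℝ (Fin n) → ℂ} {x : EuclideanSpace ℝ (Fin n)}
    (hf : DifferentiableAt ℝ f x) (hψ : DifferentiableAt ℝ ψ x) (i : Fin n) :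
    cpartialDeriv i (fun x => f x * ψ x) x =
      cpartialDeriv i f x * ψ x + f x * cpartialDeriv i ψ x := by
  unfold cpartialDeriv
  rw [fderiv_fun_mul hf hψ]
  simp
  ring

lemma cpartialDeriv_ofReal {f : EuclideanSpace ℝ (Fin n) → ℝ} {x : EuclideanSpace ℝ (Fin n)}
    (hf : DifferentiableAt ℝ f x) (i : Fin n) :
    cpartialDeriv i (fun x => (f x : ℂ)) x = (partialDeriv i f x : ℂ) := by
  have h := (Complex.ofRealCLM.hasFDerivAt (x := f x)).comp x hf.hasFDerivAt
  unfold cpartialDeriv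
  rw [show (fun x => (f x : ℂ)) = Complex.ofRealCLM ∘ f from rfl, h.fderiv]
  simp [partialDeriv]

lemma IsTestFunction.isC1TestFunction {φ : EuclideanSpace ℝ (Fin n) → ℝ}
    (hφ : IsTestFunction Ω φ) : IsC1TestFunction Ω (fun x => (φ x : ℂ)) := by
  refine ⟨Complex.ofRealCLM.contDiff.comp (hφ.1.of_le (by exact_mod_cast le_top)),
    hφ.2.1.comp_left Complex.ofReal_zero, ?_⟩
  exact (tsupport_comp_subset (g := fun r : ℝ => (r : ℂ)) Complex.ofReal_zero φ).trans hφ.2.2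

/-- Multiplication by a weight `E` with logarithmic gradient `θ` turns a solution `ρ` of
`Δρ + 2 ξ·∇ρ + Q ρ = 0` into a solution `E ρ` of `Δm + 2 (ξ - θ)·∇m + q m = 0`, provided
`Q = q + ∑ᵢ (∂ᵢθᵢ + 2 ξᵢ θᵢ - θᵢ²)`. -/
lemma weight_mul_solution (hΩ : IsOpen Ω) {ξ : Fin n → ℂ}
    {ρ Q q E : EuclideanSpace ℝ (Fin n) → ℂ} {g θ : Fin n → EuclideanSpace ℝ (Fin n) → ℂ}
    (hρ : MemLp ρ 2 (volume.restrict Ω)) (hg : ∀ i, MemLp (g i) 2 (volume.restrict Ω))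
    (hgrad : ∀ ψ, IsC1TestFunction Ω ψ → ∀ i,
      ∫ x in Ω, ρ x * cpartialDeriv i ψ x = -∫ x in Ω, g i x * ψ x)
    (heq : ∀ ψ, IsC1TestFunction Ω ψ →
      -(∑ i, ∫ x in Ω, g i x * cpartialDeriv i ψ x) + 2 * (∑ i, ξ i * ∫ x in Ω, g i x * ψ x)
        + ∫ x in Ω, Q x * ρ x * ψ x = 0)
    (hE : ContDiffOn ℝ 1 E Ω) (hEb : MemLp E ⊤ (volume.restrict Ω))
    (hEθ : ∀ x ∈ Ω, ∀ i, cpartialDeriv i E x = E x * θ i x)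
    (hθ : ∀ i, ContDiffOn ℝ 1 (θ i) Ω) (hθb : ∀ i, MemLp (θ i) ⊤ (volume.restrict Ω))
    (hθd : ∀ i, MemLp (cpartialDeriv i (θ i)) ⊤ (volume.restrict Ω))
    (hq : MemLp q ⊤ (volume.restrict Ω))
    (hQ : ∀ᵐ x ∂volume.restrict Ω,
      Q x = q x + ∑ i, (cpartialDeriv i (θ i) x + 2 * ξ i * θ i x - θ i x ^ 2)) :
    MemLp (fun x => E x * ρ x) 2 (volume.restrict Ω) ∧
    (∀ i, MemLp (fun x => E x * (θ i x * ρ x + g i x)) 2 (volume.restrict Ω)) ∧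
    (∀ φ, IsC1TestFunction Ω φ → ∀ i, ∫ x in Ω, E x * ρ x * cpartialDeriv i φ x =
      -∫ x in Ω, E x * (θ i x * ρ x + g i x) * φ x) ∧
    ∀ φ, IsC1TestFunction Ω φ →
      -(∫ x in Ω, ∑ i, E x * (θ i x * ρ x + g i x) * cpartialDeriv i φ x)
        + (∫ x in Ω, (∑ i, 2 * (ξ i - θ i x) * (E x * (θ i x * ρ x + g i x))) * φ x)
        + (∫ x in Ω, q x * (E x * ρ x) * φ x) = 0 := by
  have hmul : ∀ {f u : EuclideanSpace ℝ (Fin n) → ℂ}, MemLp f ⊤ (volume.restrict Ω) →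
      MemLp u 2 (volume.restrict Ω) → MemLp (fun x => f x * u x) 2 (volume.restrict Ω) :=
    fun hf hu => hu.mul' hf
  have hint : ∀ {u ψ : EuclideanSpace ℝ (Fin n) → ℂ}, MemLp u 2 (volume.restrict Ω) →
      IsC1TestFunction Ω ψ → Integrable (fun x => u x * ψ x) (volume.restrict Ω) :=
    fun hu hψ => hu.integrable_mul (hψ.memLp 2 _)
  have hintd : ∀ {u ψ : EuclideanSpace ℝ (Fin n) → ℂ}, MemLp u 2 (volume.restrict Ω) →
      IsC1TestFunction Ω ψ → ∀ i,
      Integrable (fun x => u x * cpartialDeriv i ψ x) (volume.restrict Ω) :=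
    fun hu hψ i => hu.integrable_mul (hψ.memLp_cpartialDeriv i 2 _)
  have hm : MemLp (fun x => E x * ρ x) 2 (volume.restrict Ω) := hmul hEb hρ
  have hG : ∀ i, MemLp (fun x => E x * (θ i x * ρ x + g i x)) 2 (volume.restrict Ω) := fun i =>
    hmul hEb ((hmul (hθb i) hρ).add (hg i))
  have hd : ∀ {f : EuclideanSpace ℝ (Fin n) → ℂ}, ContDiffOn ℝ 1 f Ω → ∀ x ∈ Ω,
      DifferentiableAt ℝ f x := fun hf x hx =>
    (hf.contDiffAt (hΩ.mem_nhds hx)).differentiableAt one_ne_zero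
  refine ⟨hm, hG, fun φ hφ i => ?_, fun φ hφ => ?_⟩
  · have hψ := hφ.mul hΩ hE
    have hχ := hψ.mul hΩ (hθ i)
    have h1 := hgrad _ hψ i
    calc ∫ x in Ω, E x * ρ x * cpartialDeriv i φ x
        = ∫ x in Ω, (ρ x * cpartialDeriv i (fun x => E x * φ x) x
            - ρ x * (θ i x * (E x * φ x))) := by
          refine setIntegral_congr_fun hΩ.measurableSet fun x hx => ?_
          rw [cpartialDeriv_mul (hd hE x hx) (hφ.1.differentiable one_ne_zero x), hEθ x hx]
          ring
      _ = -((∫ x in Ω, g i x * (E x * φ x)) + ∫ x in Ω, ρ x * (θ i x * (E x * φ x))) := by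
          rw [integral_sub (hintd hρ hψ i) (hint hρ hχ), h1]; ring
      _ = _ := by
          rw [← integral_add (hint (hg i) hψ) (hint hρ hχ)]
          refine congrArg _ (integral_congr_ae (ae_of_all _ fun x => ?_))
          ring
  · have hψ := hφ.mul hΩ hE
    set ψ := fun x => E x * φ x with hψdef
    have hη : ∀ i, MemLp (fun x => (cpartialDeriv i (θ i) x + 2 * ξ i * θ i x - θ i x ^ 2) * ρ x)
        2 (volume.restrict Ω) := fun i => by
      refine hmul (((hθd i).add ((hθb i).const_mul (2 * ξ i))).sub ?_) hρ
      simpa only [pow_two] using (hθb i).mul' (hθb i)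
    have hdrift : ∀ i, MemLp (fun x => 2 * (ξ i - θ i x) * (E x * (θ i x * ρ x + g i x))) 2
        (volume.restrict Ω) := fun i => by
      have h1 : MemLp (fun x => 2 * (ξ i - θ i x)) ⊤ (volume.restrict Ω) :=
        ((memLp_top_const (ξ i)).sub (hθb i)).const_mul 2
      exact hmul h1 (hG i)
    have hi : ∀ i, -(∫ x in Ω, E x * (θ i x * ρ x + g i x) * cpartialDeriv i φ x)
        + (∫ x in Ω, 2 * (ξ i - θ i x) * (E x * (θ i x * ρ x + g i x)) * φ x) =
        -(∫ x in Ω, g i x * cpartialDeriv i ψ x) + 2 * (ξ i * ∫ x in Ω, g i x * ψ x)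
        + ∫ x in Ω, (cpartialDeriv i (θ i) x + 2 * ξ i * θ i x - θ i x ^ 2) * ρ x * ψ x := by
      intro i
      have hχ := hψ.mul hΩ (hθ i)
      have h0 : (∫ x in Ω, ρ x * cpartialDeriv i (fun x => θ i x * ψ x) x)
          + ∫ x in Ω, g i x * (θ i x * ψ x) = 0 := by
        rw [hgrad _ hχ i, neg_add_cancel]
      have i1 := hintd (hg i) hψ i
      have i2 : Integrable (fun x => 2 * ξ i * (g i x * ψ x)) (volume.restrict Ω) :=
        (hint (hg i) hψ).const_mul _
      have i3 : Integrable (fun x => 2 * ξ i * (g i x * ψ x) - g i x * cpartialDeriv i ψ x)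
        (volume.restrict Ω) := i2.sub i1
      have i4 := hint (hη i) hψ
      have i5 := hintd hρ hχ i
      have i6 := hint (hg i) hχ
      have i34 : Integrable (fun x => 2 * ξ i * (g i x * ψ x) - g i x * cpartialDeriv i ψ x
          + (cpartialDeriv i (θ i) x + 2 * ξ i * θ i x - θ i x ^ 2) * ρ x * ψ x)
        (volume.restrict Ω) := i3.add i4
      have i56 : Integrable (fun x => ρ x * cpartialDeriv i (fun x => θ i x * ψ x) x
          + g i x * (θ i x * ψ x)) (volume.restrict Ω) := i5.add i6
      have hpt : ∫ x in Ω, (2 * (ξ i - θ i x) * (E x * (θ i x * ρ x + g i x)) * φ x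
            - E x * (θ i x * ρ x + g i x) * cpartialDeriv i φ x) =
          ∫ x in Ω, (2 * ξ i * (g i x * ψ x) - g i x * cpartialDeriv i ψ x
            + (cpartialDeriv i (θ i) x + 2 * ξ i * θ i x - θ i x ^ 2) * ρ x * ψ x
            - (ρ x * cpartialDeriv i (fun x => θ i x * ψ x) x + g i x * (θ i x * ψ x))) := by
        refine setIntegral_congr_fun hΩ.measurableSet fun x hx => ?_
        have hψx := hψ.1.differentiable one_ne_zero x
        rw [cpartialDeriv_mul (hd (hθ i) x hx) hψx, hψdef,
          cpartialDeriv_mul (hd hE x hx) (hφ.1.differentiable one_ne_zero x), hEθ x hx]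
        ring
      rw [integral_sub (hint (hdrift i) hφ) (hintd (hG i) hφ i),
        integral_sub i34 i56, integral_add i3 i4, integral_sub i2 i1,
        integral_add i5 i6, h0, integral_const_mul] at hpt
      linear_combination hpt
    have hQi : ∫ x in Ω, Q x * ρ x * ψ x = (∫ x in Ω, q x * (E x * ρ x) * φ x) +
        ∑ i, ∫ x in Ω, (cpartialDeriv i (θ i) x + 2 * ξ i * θ i x - θ i x ^ 2) * ρ x * ψ x := by
      rw [← integral_finsetSum _ fun i _ => hint (hη i) hψ,
        ← integral_add (hint (hmul hq hm) hφ)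
          (integrable_finsetSum _ fun i _ => hint (hη i) hψ)]
      refine integral_congr_ae ?_
      filter_upwards [hQ] with x hx
      rw [hx, ← Finset.sum_mul, ← Finset.sum_mul, hψdef]
      ring
    have hfin := heq ψ hψ
    have hsum := Finset.sum_congr (rfl : (Finset.univ : Finset (Fin n)) = Finset.univ)
      fun i _ => hi i
    simp only [Finset.sum_add_distrib, Finset.sum_neg_distrib, ← Finset.mul_sum] at hsum
    simp only [Finset.sum_mul]
    rw [integral_finsetSum _ fun i _ => hintd (hG i) hφ i,
      integral_finsetSum _ fun i _ => hint (hdrift i) hφ]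
    rw [hQi] at hfin
    linear_combination hfin + hsum

end

/-! ### The exponential weight -/

section

variable {n : ℕ} {Ω : Set (EuclideanSpace ℝ (Fin n))}

lemma contDiffOn_one_of_partialDeriv (hΩ : IsOpen Ω) {v : EuclideanSpace ℝ (Fin n) → ℝ}
    (hv : DifferentiableOn ℝ v Ω) (hc : ∀ i, ContinuousOn (partialDeriv i v) Ω) :
    ContDiffOn ℝ 1 v Ω := by
  have h := (contDiffOn_succ_iff_fderiv_of_isOpen (𝕜 := ℝ) (n := 0) (f := v) hΩ).2
    ⟨hv, by simp, contDiffOn_zero.2 ?_⟩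
  · simpa using h
  have : fderiv ℝ v = fun x => ∑ i, partialDeriv i v x •
      (EuclideanSpace.proj i : EuclideanSpace ℝ (Fin n) →L[ℝ] ℝ) := by
    funext x
    ext y
    rw [fderiv_eq_sum_partialDeriv]
    simp [mul_comm]
  rw [this]
  exact continuousOn_finsetSum _ fun i _ => (hc i).smul continuousOn_const

/-- The linear form `x ↦ ξ·x`. -/
noncomputable def dotCLM (ξ : EuclideanSpace ℂ (Fin n)) : EuclideanSpace ℝ (Fin n) →L[ℝ] ℂ :=
  ∑ i, ξ i • (Complex.ofRealCLM ∘L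
    (EuclideanSpace.proj i : EuclideanSpace ℝ (Fin n) →L[ℝ] ℝ))

lemma dotCLM_apply (ξ : EuclideanSpace ℂ (Fin n)) (x : EuclideanSpace ℝ (Fin n)) :
    dotCLM ξ x = ∑ i, ξ i * (x i : ℂ) := by
  simp [dotCLM]

/-- The exponential prefactor `e^{ξ·x - s v/2}`. -/
noncomputable def cgoWeight (s : ℝ) (v : EuclideanSpace ℝ (Fin n) → ℝ)
    (ξ : EuclideanSpace ℂ (Fin n)) (x : EuclideanSpace ℝ (Fin n)) : ℂ :=
  Complex.exp ((∑ i, ξ i * (x i : ℂ)) - (s : ℂ) / 2 * (v x : ℂ))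

lemma cgoWeight_eq (s : ℝ) (v : EuclideanSpace ℝ (Fin n) → ℝ) (ξ : EuclideanSpace ℂ (Fin n)) :
    cgoWeight s v ξ = fun x => Complex.exp (dotCLM ξ x - (s : ℂ) / 2 * (v x : ℂ)) := by
  funext x
  rw [cgoWeight, dotCLM_apply]

lemma contDiffOn_cgoWeight {v : EuclideanSpace ℝ (Fin n) → ℝ} (hv : ContDiffOn ℝ 1 v Ω) (s : ℝ)
    (ξ : EuclideanSpace ℂ (Fin n)) : ContDiffOn ℝ 1 (cgoWeight s v ξ) Ω := by
  rw [cgoWeight_eq]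
  exact Complex.contDiff_exp.comp_contDiffOn ((dotCLM ξ).contDiff.contDiffOn.sub
    (contDiffOn_const.mul (Complex.ofRealCLM.contDiff.comp_contDiffOn hv)))

/-- The logarithmic gradient of `e^{ξ·x - s v/2}` is `ξ - s ∇v/2`. -/
lemma cpartialDeriv_cgoWeight {v : EuclideanSpace ℝ (Fin n) → ℝ} {x : EuclideanSpace ℝ (Fin n)}
    (hv : DifferentiableAt ℝ v x) (s : ℝ) (ξ : EuclideanSpace ℂ (Fin n)) (i : Fin n) :
    cpartialDeriv i (cgoWeight s v ξ) x =
      cgoWeight s v ξ x * (ξ i - (s : ℂ) / 2 * (partialDeriv i v x : ℂ)) := by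
  rw [cgoWeight_eq]
  have h1 := (Complex.ofRealCLM.hasFDerivAt (x := v x)).comp x hv.hasFDerivAt
  have h2 := (((dotCLM ξ).hasFDerivAt (x := x)).sub (h1.const_mul ((s : ℂ) / 2))).cexp
  have h3 := h2.fderiv
  unfold cpartialDeriv
  refine (congrArg (fun T : EuclideanSpace ℝ (Fin n) →L[ℝ] ℂ => T (EuclideanSpace.single i 1))
    h3).trans ?_
  simp [partialDeriv, dotCLM_apply, apply_ite Complex.ofReal]

lemma norm_cgoWeight_le {v : EuclideanSpace ℝ (Fin n) → ℝ} {K L : ℝ} (s : ℝ)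
    (ξ : EuclideanSpace ℂ (Fin n)) {x : EuclideanSpace ℝ (Fin n)} (hv : |v x| ≤ K)
    (hx : ‖x‖ ≤ L) : ‖cgoWeight s v ξ x‖ ≤ Real.exp (‖dotCLM ξ‖ * L + |s| / 2 * K) := by
  rw [cgoWeight_eq]
  refine (Complex.norm_exp_le_exp_norm _).trans (Real.exp_le_exp.2 ?_)
  refine (norm_sub_le _ _).trans (add_le_add ?_ ?_)
  · exact ((dotCLM ξ).le_opNorm x).trans (mul_le_mul_of_nonneg_left hx (norm_nonneg _))
  · rw [norm_mul, norm_div, Complex.norm_real, Complex.norm_real, Complex.norm_ofNat,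
      Real.norm_eq_abs, Real.norm_eq_abs]
    exact mul_le_mul_of_nonneg_left hv (by positivity)

end

end CGO


open CGO MeasureTheory

theorem mainTheorem6 {n : ℕ} (Ω : Set (EuclideanSpace ℝ (Fin n)))
    (hΩ : CGO.IsBoundedLipschitzDomain Ω)
    (v₀ : EuclideanSpace ℝ (Fin n) → ℝ) (hv₀ : DifferentiableOn ℝ v₀ Ω)
    (hgrad : ∀ i, CGO.MemC1 Ω (CGO.partialDeriv i v₀))
    (q : EuclideanSpace ℝ (Fin n) → ℂ)
    (hq : MeasureTheory.MemLp q ⊤ (MeasureTheory.volume.restrict Ω))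
    (s : ℝ) (hs : s = 1 ∨ s = -1) :
    ∃ C R : ℝ, 0 < C ∧ 0 < R ∧
      ∀ ξ : EuclideanSpace ℂ (Fin n), ∑ i, ξ i * ξ i = 0 → R ≤ ‖ξ‖ →
        ∃ ω : EuclideanSpace ℝ (Fin n) → ℂ,
          CGO.MemH1 Ω ω ∧
          CGO.IsWeakSolution Ω s v₀ q (CGO.cgoForm s v₀ ξ ω) ∧
          MeasureTheory.eLpNorm ω 2 (MeasureTheory.volume.restrict Ω) ≤
            ENNReal.ofReal (C * ‖ξ‖⁻¹) := by
  have hΩo := hΩ.isOpen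
  set w : Fin n → EuclideanSpace ℝ (Fin n) → ℝ := fun i => partialDeriv i v₀ with hw
  have hwC : ∀ i, ContDiffOn ℝ 1 (w i) Ω := fun i => (hgrad i).1
  have hwd : ∀ i, ∀ x ∈ Ω, DifferentiableAt ℝ (w i) x := fun i x hx =>
    ((hwC i).contDiffAt (hΩo.mem_nhds hx)).differentiableAt one_ne_zero
  choose N hN using fun i => (hgrad i).2
  obtain ⟨M, hM⟩ : ∃ M : ℝ, ∀ i, N i ≤ M :=
    ⟨∑ i, |N i|, fun i => (le_abs_self _).trans
      (Finset.single_le_sum (f := fun i => |N i|) (fun _ _ => abs_nonneg _) (Finset.mem_univ i))⟩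
  obtain ⟨Kv, hKv⟩ := hΩ.exists_bound hv₀ fun x hx i => (hN i x hx).1.trans (hM i)
  have hvC : ContDiffOn ℝ 1 v₀ Ω :=
    contDiffOn_one_of_partialDeriv hΩo hv₀ fun i => (hwC i).continuousOn
  obtain ⟨L, hL, hΩL⟩ := hΩ.isBounded.subset_ball_lt 0 0
  have hwb : ∀ i, MemLp (fun x => (w i x : ℂ)) ⊤ (volume.restrict Ω) := fun i =>
    memLp_top_of_continuousOn hΩo (Complex.continuous_ofReal.comp_continuousOn (hwC i).continuousOn)
      fun x hx => by rw [Complex.norm_real]; exact (hN i x hx).1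
  have hwwb : ∀ i, MemLp (fun x => (partialDeriv i (w i) x : ℂ)) ⊤ (volume.restrict Ω) := fun i =>
    memLp_top_of_continuousOn hΩo (Complex.continuous_ofReal.comp_continuousOn
      (((hwC i).continuousOn_fderiv_of_isOpen hΩo le_rfl).clm_apply continuousOn_const))
      fun x hx => by rw [Complex.norm_real]; exact (hN i x hx).2 i
  -- the potential of the Schrödinger equation satisfied by `e^{s v₀ / 2} m`
  have hP : MemLp (fun x => q x - ∑ i, ((s : ℂ) / 2 * (partialDeriv i (w i) x : ℂ)
      + ((s : ℂ) / 2 * (w i x : ℂ)) ^ 2)) ⊤ (volume.restrict Ω) := by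
    refine hq.sub (memLp_finsetSum _ fun i _ => ((hwwb i).const_mul _).add ?_)
    have h := (hwb i).const_mul ((s : ℂ) / 2)
    simpa only [pow_two] using h.mul' h
  obtain ⟨K, Q, hK, hQm, hQK, hQP⟩ := exists_bounded_version hP
  obtain ⟨C, R, hC, hR, hsol⟩ := exists_solution_on_ball (n := n) hL hK
  refine ⟨C, R, hC, hR, fun ξ hξ hξR => ?_⟩
  obtain ⟨ω, g, hω, hg, hωg, hωeq, hωC⟩ := hsol ξ hξ hξR Q hQm hQK
  have hle : volume.restrict Ω ≤ volume.restrict (Metric.ball 0 L) :=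
    Measure.restrict_mono hΩL le_rfl
  have hswap : ∀ {f ψ : EuclideanSpace ℝ (Fin n) → ℂ}, tsupport ψ ⊆ Ω →
      ∫ x in Metric.ball 0 L, f x * ψ x = ∫ x in Ω, f x * ψ x := fun h => by
    rw [setIntegral_mul_eq_integral h, setIntegral_mul_eq_integral (h.trans hΩL)]
  have hωΩ := hω.mono_measure hle
  have hgΩ := fun i => (hg i).mono_measure hle
  have hωg' : ∀ ψ, IsC1TestFunction Ω ψ → ∀ i,
      ∫ x in Ω, ω x * cpartialDeriv i ψ x = -∫ x in Ω, g i x * ψ x := fun ψ hψ i => by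
    have h := hωg ψ (hψ.mono hΩL) i
    rwa [hswap ((IsC1TestFunction.tsupport_cpartialDeriv i).trans hψ.2.2),
      hswap hψ.2.2] at h
  have hfin : IsFiniteMeasure (volume.restrict Ω) :=
    isFiniteMeasure_restrict.2 hΩ.isBounded.measure_lt_top.ne
  have hρ : MemLp (fun x => 1 + ω x) 2 (volume.restrict Ω) :=
    MemLp.add (f := fun _ => (1 : ℂ)) (memLp_const 1) hωΩ
  set E := cgoWeight s v₀ ξ with hE
  set θ : Fin n → EuclideanSpace ℝ (Fin n) → ℂ := fun i x => ξ i - (s : ℂ) / 2 * (w i x : ℂ)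
    with hθ
  have hθC : ∀ i, ContDiffOn ℝ 1 (θ i) Ω := fun i => contDiffOn_const.sub
    (contDiffOn_const.mul (Complex.ofRealCLM.contDiff.comp_contDiffOn (hwC i)))
  have hθd : ∀ i, ∀ x ∈ Ω, cpartialDeriv i (θ i) x =
      -((s : ℂ) / 2 * (partialDeriv i (w i) x : ℂ)) := fun i x hx => by
    have h1 := (Complex.ofRealCLM.hasFDerivAt (x := w i x)).comp x (hwd i x hx).hasFDerivAt
    have h2 := ((h1.const_mul ((s : ℂ) / 2)).const_sub (ξ i)).fderiv
    refine (congrArg (fun T : EuclideanSpace ℝ (Fin n) →L[ℝ] ℂ => T (EuclideanSpace.single i 1))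
      h2).trans ?_
    simp [partialDeriv]
  obtain ⟨hm, hG, hmg, hmeq⟩ := weight_mul_solution (E := E) (θ := θ) (Q := Q) (q := q)
    (ξ := fun i => ξ i) hΩo hρ hgΩ
    (fun ψ hψ i => by
      have h1 := integral_planeWave_mul_cpartialDeriv hψ 0 i
      simp only [planeWave, inner_zero_left, Complex.ofReal_zero, zero_mul, Complex.exp_zero,
        PiLp.zero_apply, mul_zero, neg_zero, one_mul] at h1
      have h2 : Integrable (cpartialDeriv i ψ) (volume.restrict Ω) :=
        memLp_one_iff_integrable.1 (hψ.memLp_cpartialDeriv i 1 _)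
      have h3 : Integrable (fun x => ω x * cpartialDeriv i ψ x) (volume.restrict Ω) :=
        hωΩ.integrable_mul (hψ.memLp_cpartialDeriv i 2 _)
      simp only [add_mul, one_mul]
      rw [integral_add h2 h3, h1, hωg' ψ hψ i, zero_add])
    (fun ψ hψ => by
      have h := hωeq ψ (hψ.mono hΩL)
      rw [hswap hψ.2.2] at h
      simp only [hswap hψ.2.2,
        hswap ((IsC1TestFunction.tsupport_cpartialDeriv _).trans hψ.2.2)] at h
      exact h)
    (contDiffOn_cgoWeight hvC s ξ)
    (memLp_top_of_continuousOn hΩo (contDiffOn_cgoWeight hvC s ξ).continuousOn fun x hx =>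
      norm_cgoWeight_le s ξ (hKv x hx) (mem_ball_zero_iff.1 (hΩL hx)).le)
    (fun x hx i => cpartialDeriv_cgoWeight
      ((hv₀ x hx).differentiableAt (hΩo.mem_nhds hx)) s ξ i)
    hθC (fun i => (memLp_top_const (ξ i)).sub ((hwb i).const_mul _))
    (fun i => (((hwwb i).const_mul ((s : ℂ) / 2)).neg).ae_eq (by
      filter_upwards [ae_restrict_mem hΩo.measurableSet] with x hx
      rw [hθd i x hx]; rfl))
    hq
    (by
      filter_upwards [hQP, ae_restrict_mem hΩo.measurableSet] with x hx hxΩ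
      have h0 : ∑ i, (cpartialDeriv i (θ i) x + 2 * ξ i * θ i x - θ i x ^ 2) =
          ∑ i, ξ i * ξ i - ∑ i, ((s : ℂ) / 2 * (partialDeriv i (w i) x : ℂ)
            + ((s : ℂ) / 2 * (w i x : ℂ)) ^ 2) := by
        rw [← Finset.sum_sub_distrib]
        refine Finset.sum_congr rfl fun i _ => ?_
        rw [hθd i x hxΩ, hθ]
        ring
      rw [hx, h0, hξ]
      ring)
  have hcast : ∀ {φ : EuclideanSpace ℝ (Fin n) → ℝ}, IsTestFunction Ω φ → ∀ i x,
      (partialDeriv i φ x : ℂ) = cpartialDeriv i (fun x => (φ x : ℂ)) x := fun hφ i x =>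
    (cpartialDeriv_ofReal (hφ.1.differentiable (by simp) x) i).symm
  refine ⟨ω, ⟨g, hωΩ, hgΩ, fun i φ hφ => ?_⟩, ⟨fun i x => E x * (θ i x * (1 + ω x) + g i x),
    ⟨hm, hG, fun i φ hφ => ?_⟩, fun φ hφ => ?_⟩, (eLpNorm_mono_measure ω hle).trans hωC⟩
  · simp only [hcast hφ]
    exact hωg' _ hφ.isC1TestFunction i
  · simp only [hcast hφ]
    exact hmg _ hφ.isC1TestFunction i
  · have h := hmeq _ hφ.isC1TestFunction
    simp only [hcast hφ]
    have hdrift : ∀ x, (s : ℂ) * (∑ i, (partialDeriv i v₀ x : ℂ) *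
        (E x * (θ i x * (1 + ω x) + g i x))) =
        ∑ i, 2 * (ξ i - θ i x) * (E x * (θ i x * (1 + ω x) + g i x)) := fun x => by
      rw [Finset.mul_sum]
      refine Finset.sum_congr rfl fun i _ => ?_
      simp only [hθ, hw]
      ring
    simp only [hdrift]
    exact h
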